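/- Let $q,\mu,\nu\in\mathbb C$ with $q^k\neq 1$ for all $k\ge 1$, $\nu q^k\ne 1$ for all $k\ge 0$, and either $\mu\neq 0$ or $\mu=\nu=0$. Put $(a;q)_n=\prod_{k=0}^{n-1}(1-aq^k)$, $$\varphi(m|n)=\mu^m\frac{(\nu/\mu;q)_m(\mu;q)_{n-m}}{(\nu;q)_n}\,\frac{(q;q)_n}{(q;q)_m(q;q)_{n-m}}\quad(0\le m\le n),\qquad \varphi(m|n)=0\quad(m>n),$$ (for $\mu=\nu=0$: $\varphi(m|n)=\delta_{m,0}$) and $f(n)=(\nu;q)_n/(q;q)_n$. For $0\le\nu\le\mu<1$, $|q|<1$ the $\varphi(\cdot|n)$ are probability distributions. Let $\mathcal L$ be $\mathbb Z$ or $\mathbb Z/L\mathbb Z$ with $L\ge1$. Configurations are occupation numbers $\mathbf n=(n_i)_{i\in\mathcal L}$ with $N=\sum_i n_i<\infty$ particles. In the chipping model all sites are updated in parallel, and $m$ of the $n$ particles of a site jump one site to the right with weight $\varphi(m|n)$, so that $$\mathbf M_{\mathbf n,\mathbf n'}=\sum_{(m_k)_{k\in\mathcal L}}\ \prod_{i\in\mathcal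 L}\delta_{n_i-n_i',\,m_{i-1}-m_i}\,\varphi(m_i|n_i').$$ Let $P_{st}(\mathbf n)=\prod_i f(n_i)$, let $\mathbf S$ be diagonal with $\mathbf S_{\mathbf n,\mathbf n}=1/P_{st}(\mathbf n)$, and let $\mathbf M^0=\mathbf S\mathbf M\mathbf S^{-1}$. Configurations are also written as weakly increasing coordinates $\mathbf x=(x_1\le\dots\le x_N)$ in $\mathbb Z$, respectively in $\{0,\dots,L-1\}$ for the ring. For $u=(u_1,\dots,u_N)\in\mathbb C^N$ with $u_i\ne1$, $\nu u_i\neq1$ for all $i$ and $u_i\ne qu_j$ for $i<j$ define, for $\mathbf x\in\mathbb Z^N$, $$\Psi^0(\mathbf x|u)=\sum_{\sigma\in S_N}\mathrm{sgn}(\sigma)\prod_{i<j}\frac{u_{\sigma_i}-qu_{\sigma_j}}{u_i-qu_j}\prod_{i=1}^N\Big(\frac{1-\nu u_{\sigma_i}}{1-u_{\sigma_i}}\Big)^{x_i},\qquad \Lambda(u)=\prod_{i=1}^N\frac{1-\mu u_i}{1-\nu u_i}.$$ Let $\hat\Pi\mathbf x=(-x_N,\dots,-x_1)$. 1. On $\mathbb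 Z$, for every $N\ge 0$: $P_{st}$ is stationary, $\mathbf MP_{st}=P_{st}$. For all $u$ as above, $\mathbf M^0\Psi^0=\Lambda(u)\Psi^0$; the function $P_{st}(\mathbf x)\Psi^0(\mathbf x|u)$ satisfies the right eigenvector equation of $\mathbf M$ and $\Psi^0(\hat\Pi\mathbf x|u)$ the left one, both with eigenvalue $\Lambda(u)$. If the $u_i$ are pairwise distinct, these three functions are not identically zero on the configurations, so that they are eigenvectors. 2. On the ring of $L\ge1$ sites, $P_{st}$ is stationary. Let moreover $u_i\ne qu_j$ for all $i\neq j$. Consider the Bethe equations $$\Big(\frac{1-\nu u_i}{1-u_i}\Big)^L=(-1)^{N-1}\prod_{j\neq i}\frac{u_i-qu_j}{u_j-qu_i},\qquad i=1,\dots,N.$$ (a) If the $u_i$ are pairwise distinct and $\Psi^0(x_1,\dots,x_N|u)=\Psi^0(x_2,\dots,x_N,x_1+L|u)$ for all integers $x_1\le\dots\le x_N\le x_1+L$, then $u$ satisfies the Bethe equations. (b) If $u$ satisfies the Bethe equations, then this periodicity holds for all $\mathbf x\in\mathbb Z^N$, and the statements of 1 about $\Psi^0(\mathbf x|u)$, $P_{st}(\mathbf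 x)\Psi^0(\mathbf x|u)$ and $\Psi^0(\hat\Pi\mathbf x|u)$ hold for the matrices $\mathbf M^0$ and $\mathbf M$ of the ring, including non-vanishing for pairwise distinct $u_i$. -/

import Mathlib

open scoped BigOperators

noncomputable section

namespace Chipping

/-- The finite `q`-Pochhammer symbol `(a;q)_n = ∏_{k=0}^{n-1} (1 - a q^k)`. -/
def qPoch (a q : ℂ) (n : ℕ) : ℂ := ∏ k ∈ Finset.range n, (1 - a * q ^ k)

/-- The jumping probabilities `φ(m|n)`, with `φ(m|n) = 0` for `m > n`. -/
def phi (q μ ν : ℂ) (m n : ℕ) : ℂ :=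
  if m ≤ n then
    μ ^ m * (qPoch (ν / μ) q m * qPoch μ q (n - m) / qPoch ν q n) *
      (qPoch q q n / (qPoch q q m * qPoch q q (n - m)))
  else 0

/-- The one-site weight `f(n) = (ν;q)_n / (q;q)_n`. -/
def siteWeight (q ν : ℂ) (n : ℕ) : ℂ := qPoch ν q n / qPoch q q n

section Model

/- `Site` is the lattice, `ℤ` or `ZMod L`; a configuration is given by its
occupation numbers `n : Site →₀ ℕ`. -/
variable {Site : Type} [AddCommGroupWithOne Site]

/-- The product measure `P_st(n) = ∏_i f(n_i)`; as `f(0) = 1` the product is finite. -/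
def stationaryWeight (q ν : ℂ) (n : Site →₀ ℕ) : ℂ := ∏ᶠ i : Site, siteWeight q ν (n i)

/-- The one-site factor `δ_{n_i - n'_i, m_{i-1} - m_i} φ(m_i | n'_i)`, where `m_i` is the number
of particles that jump from the site `i` to the site `i + 1`. -/
def siteFactor (q μ ν : ℂ) (n n' m : Site →₀ ℕ) (i : Site) : ℂ :=
  if (n i : ℤ) - (n' i : ℤ) = (m (i - 1) : ℤ) - (m i : ℤ) then phi q μ ν (m i) (n' i) else 0

/-- The probability `M_{n,n'}` of the transition from `n'` to `n` under the parallel update.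
Only `m` with `m i ≤ n' i` for all `i` contribute, so that `m` may be taken finitely supported;
the sum and the products are then finite. -/
def transition (q μ ν : ℂ) (n n' : Site →₀ ℕ) : ℂ :=
  ∑ᶠ m : Site →₀ ℕ, ∏ᶠ i : Site, siteFactor q μ ν n n' m i

/-- The occupation numbers of `N` particles at the sites `s 0, …, s (N - 1)`. -/
def occupation {N : ℕ} (s : Fin N → Site) : Site →₀ ℕ := ∑ j : Fin N, Finsupp.single (s j) 1

/- `X` labels the configurations of the sector, `occ` gives their occupation numbers. -/
variable {X : Type}

/-- The Markov matrix in a sector. -/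
def markovMatrix (q μ ν : ℂ) (occ : X → Site →₀ ℕ) : Matrix X X ℂ :=
  fun x y => transition q μ ν (occ x) (occ y)

/-- The stationary measure in a sector. -/
def stationaryMeasure (q ν : ℂ) (occ : X → Site →₀ ℕ) : X → ℂ :=
  fun x => stationaryWeight q ν (occ x)

/-- The diagonal entries `1 / P_st` of the diagonal matrix `S`. -/
def conjDiag (q ν : ℂ) (occ : X → Site →₀ ℕ) : X → ℂ :=
  fun x => 1 / stationaryMeasure q ν occ x

/-- The conjugated Markov matrix `M⁰ = S M S⁻¹`. -/
def conjMarkovMatrix (q μ ν : ℂ) (occ : X → Site →₀ ℕ) : Matrix X X ℂ :=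
  fun x y => conjDiag q ν occ x * markovMatrix q μ ν occ x y * (conjDiag q ν occ y)⁻¹

end Model

/-- `A ψ = lam ψ` for the column vector `ψ`. -/
def RightEigenEq {X : Type} (A : Matrix X X ℂ) (lam : ℂ) (ψ : X → ℂ) : Prop :=
  ∀ x, HasSum (fun y => A x y * ψ y) (lam * ψ x)

/-- `ψᵀ A = lam ψᵀ` for the row vector `ψᵀ`. -/
def LeftEigenEq {X : Type} (A : Matrix X X ℂ) (lam : ℂ) (ψ : X → ℂ) : Prop :=
  ∀ y, HasSum (fun x => ψ x * A x y) (lam * ψ y)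

/-- `N`-particle configurations on `ℤ`: weakly increasing coordinates `x_1 ≤ … ≤ x_N`. -/
abbrev LineConfig (N : ℕ) : Type := Fin N →o ℤ

/-- Occupation numbers of a configuration on `ℤ`. -/
def lineOcc {N : ℕ} (x : LineConfig N) : ℤ →₀ ℕ := occupation x

/-- `N`-particle configurations on the ring of `L` sites:
coordinates `0 ≤ x_1 ≤ … ≤ x_N ≤ L - 1`. -/
abbrev RingConfig (L N : ℕ) : Type := Fin N →o Fin L

/-- Occupation numbers of a configuration on the ring `ℤ / L ℤ`. -/
def ringOcc {L N : ℕ} (x : RingConfig L N) : ZMod L →₀ ℕ :=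
  occupation (fun j => (((x j : Fin L) : ℕ) : ZMod L))

/-- The integer coordinates of a configuration on the ring. -/
def ringCoord {L N : ℕ} (x : RingConfig L N) : Fin N → ℤ := fun j => (((x j : Fin L) : ℕ) : ℤ)

/-- The Bethe function `Ψ⁰(x|u)`, for all integer coordinates `x`. -/
def betheFn (q ν : ℂ) {N : ℕ} (u : Fin N → ℂ) (x : Fin N → ℤ) : ℂ :=
  ∑ σ : Equiv.Perm (Fin N), ((Equiv.Perm.sign σ : ℤ) : ℂ) *
    (∏ i : Fin N, ∏ j ∈ Finset.Ioi i, (u (σ i) - q * u (σ j)) / (u i - q * u j)) *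
    ∏ i : Fin N, ((1 - ν * u (σ i)) / (1 - u (σ i))) ^ (x i)

/-- The eigenvalue `Λ(u) = ∏_i (1 - μ u_i) / (1 - ν u_i)`. -/
def betheEigenvalue (μ ν : ℂ) {N : ℕ} (u : Fin N → ℂ) : ℂ :=
  ∏ i : Fin N, (1 - μ * u i) / (1 - ν * u i)

/-- Parity: `(x_1, …, x_N) ↦ (-x_N, …, -x_1)`. -/
def parity {N : ℕ} (x : Fin N → ℤ) : Fin N → ℤ := fun i => -x (Fin.rev i)

/-- The map `(x_1, …, x_N) ↦ (x_2, …, x_N, x_1 + L)`. -/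
def ringShift (L : ℕ) {N : ℕ} (x : Fin N → ℤ) : Fin N → ℤ :=
  fun i => if (i : ℕ) + 1 = N then x (finRotate N i) + L else x (finRotate N i)

/-- The Bethe equations on the ring of `L` sites. The factor `j = i` of the product,
`(u_i - q u_i) / (u_i - q u_i) = 1`, is left out, so that `u_i = 0` needs no convention. -/
def BetheEquations (q ν : ℂ) (L : ℕ) {N : ℕ} (u : Fin N → ℂ) : Prop :=
  ∀ i : Fin N, ((1 - ν * u i) / (1 - u i)) ^ L =
    (-1) ^ (N - 1) * ∏ j ∈ Finset.univ.erase i, (u i - q * u j) / (u j - q * u i)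

end Chipping

end

/-! Bethe functions are matrix elements of words in a quantum plane. On functions of subsets of the
label set, a particle at `x` acts as `particle`: it adds one label `a` with amplitude `z_a ^ x`,
where `z_a = (1 - ν u_a) / (1 - u_a)`, and with an exchange factor for each label already present.
Up to a nonvanishing constant, `betheFn` at `x` is the component of `D(x_1) ⋯ D(x_N)` applied to the
vacuum, `D` being `particle`, in which all labels are present (`betheFn_eq_fullComponent`).

For fixed `x`, let `A` and `B` add a label with amplitudes `h_a = z_a ^ x / (1 - ν u_a)` and `h_a
u_a`. Then `A B = q B A`, while `D(x - 1) = A - B`, `D(x) = A - ν B`, and `A - μ B` is `D(x)` with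
each amplitude multiplied by the one-particle eigenvalue. The weights `φ` are the coefficients in `∑
φ(m|n) (A - B)^m (A - ν B)^(n-m) = (A - μ B)^n` (`planeLine_pow_eq_sum_phi`). Summing over the jumps
site by site therefore dresses every letter of the word, and the dressing comes out as `Λ(u)`
because a diagonal operator fixing the vacuum intertwines dressed and undressed letters
(`sum_jumpWeight_mul_betheFn`).

On the ring, particles that leave through one end of the word must reappear at the other. The last
letter, acting on the vacuum, can be replaced by a right addition, and right additions commute with
left ones; the Bethe equations then match the two words label by label (`fullComponent_cyclic`).

The product `φ(m|n) f(n)` splits into a function of `m` and one of `n - m`. Hence conjugation by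
`P_st` turns columns of `M` into laws of jumps to the left (`transition_mul_stationaryWeight`);
stationarity becomes `∑ φ = 1`, and parity exchanges left and right eigenvectors.

With all particles at `0` the Bethe function is a nonzero multiple of a Vandermonde product, hence
nonzero. Conversely, periodicity for particles at `-1` and `0`, resummed with `φ` at a free
parameter `μ`, isolates each Bethe equation. -/

namespace Chipping

/-! ### Lines in the quantum plane -/

section QuantumPlane

variable {E : Type*} [Ring E] [Algebra ℂ E]

/-- The element `A - c B`. -/
def planeLine (A B : E) (c : ℂ) : E := A - c • B

/-- Both products equal `A * A - q (c + d) B * A + q c d B * B`, which is symmetric in `c` and `d`.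
-/
lemma planeLine_mul_swap {q : ℂ} {A B : E} (h : A * B = q • (B * A)) (c d : ℂ) :
    planeLine A B (q * c) * planeLine A B d = planeLine A B (d * q) * planeLine A B c := by
  simp only [planeLine, sub_mul, mul_sub, smul_mul_assoc, mul_smul_comm, h, smul_sub, smul_smul]
  module

lemma planeLine_pow_mul {q : ℂ} {A B : E} (h : A * B = q • (B * A)) (ν μ : ℂ) (k : ℕ) :
    planeLine A B (q * ν) ^ k * planeLine A B μ
      = planeLine A B (μ * q ^ k) * planeLine A B ν ^ k := by
  induction k generalizing μ with
  | zero => simp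
  | succ k ih =>
    rw [pow_succ, mul_assoc, planeLine_mul_swap h, ← mul_assoc, ih, mul_assoc, ← pow_succ,
      mul_assoc, ← pow_succ']

end QuantumPlane

/-! ### The jump weights and the quantum binomial theorem -/

lemma qPoch_zero (a q : ℂ) : qPoch a q 0 = 1 := by simp [qPoch]

lemma qPoch_succ (a q : ℂ) (n : ℕ) : qPoch a q (n + 1) = qPoch a q n * (1 - a * q ^ n) := by
  simp [qPoch, Finset.prod_range_succ]

lemma qPoch_succ' (a q : ℂ) (n : ℕ) : qPoch a q (n + 1) = (1 - a) * qPoch (q * a) q n := by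
  simp only [qPoch, Finset.prod_range_succ', pow_zero, mul_one]
  rw [mul_comm]
  congr 1
  exact Finset.prod_congr rfl fun k _ => by ring

lemma qPoch_ne_zero {a q : ℂ} (h : ∀ k : ℕ, a * q ^ k ≠ 1) (n : ℕ) : qPoch a q n ≠ 0 :=
  Finset.prod_ne_zero_iff.2 fun k _ => sub_ne_zero.2 (h k).symm

lemma qPoch_self_ne_zero {q : ℂ} (h : ∀ k : ℕ, 1 ≤ k → q ^ k ≠ 1) (n : ℕ) : qPoch q q n ≠ 0 :=
  qPoch_ne_zero (fun k => by rw [← pow_succ']; exact h _ (by omega)) n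

/-- The product `∏_{k<m} (μ - ν q^k) = μ^m (ν/μ;q)_m`. -/
noncomputable def homPoch (q μ ν : ℂ) (m : ℕ) : ℂ := ∏ k ∈ Finset.range m, (μ - ν * q ^ k)

lemma homPoch_zero (q μ ν : ℂ) : homPoch q μ ν 0 = 1 := by simp [homPoch]

lemma homPoch_succ (q μ ν : ℂ) (n : ℕ) :
    homPoch q μ ν (n + 1) = homPoch q μ ν n * (μ - ν * q ^ n) := by
  simp [homPoch, Finset.prod_range_succ]

lemma homPoch_succ' (q μ ν : ℂ) (n : ℕ) :
    homPoch q μ ν (n + 1) = (μ - ν) * homPoch q μ (q * ν) n := by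
  simp only [homPoch, Finset.prod_range_succ', pow_zero, mul_one]
  rw [mul_comm]
  congr 1
  exact Finset.prod_congr rfl fun k _ => by ring

/-- For `μ = 0` also `ν = 0`, and `ν / μ = 0` by convention, so both sides are `0 ^ m`; this covers
the degenerate weight `δ_{m,0}`. -/
lemma homPoch_eq {q μ ν : ℂ} (h : μ = 0 → ν = 0) (m : ℕ) :
    homPoch q μ ν m = μ ^ m * qPoch (ν / μ) q m := by
  by_cases hμ : μ = 0
  · simp [homPoch, qPoch, h hμ, hμ]
  · rw [homPoch, qPoch, ← Finset.card_range m, ← Finset.prod_const, Finset.card_range,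
      ← Finset.prod_mul_distrib]
    refine Finset.prod_congr rfl fun k _ => ?_
    field_simp

/-- The weight `φ(i | i + j)`. -/
noncomputable def splitWeight (q μ ν : ℂ) (i j : ℕ) : ℂ :=
  homPoch q μ ν i * qPoch μ q j / qPoch ν q (i + j) *
    (qPoch q q (i + j) / (qPoch q q i * qPoch q q j))

lemma phi_eq_splitWeight {q μ ν : ℂ} (h : μ = 0 → ν = 0) {m n : ℕ} (hmn : m ≤ n) :
    phi q μ ν m n = splitWeight q μ ν m (n - m) := by
  rw [phi, if_pos hmn, splitWeight, homPoch_eq h, Nat.add_sub_cancel' hmn]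
  ring

lemma phi_zero_zero (q μ ν : ℂ) : phi q μ ν 0 0 = 1 := by
  simp [phi, qPoch_zero]

/-- A Pascal rule that replaces `ν` by `q ν`. Its two terms are the contributions of one further
factor `A - μ B` along `A - B` and `A - ν B`. -/
lemma splitWeight_succ_succ {q μ ν : ℂ} (hq : ∀ k : ℕ, 1 ≤ k → q ^ k ≠ 1)
    (hν : ∀ k : ℕ, ν * q ^ k ≠ 1) (i j : ℕ) :
    splitWeight q μ ν (i + 1) (j + 1) =
      splitWeight q μ (q * ν) i (j + 1) * ((μ * q ^ (j + 1) - ν) / (1 - ν)) +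
      splitWeight q μ (q * ν) (i + 1) j * ((1 - μ * q ^ j) / (1 - ν)) := by
  have hν' : ∀ k : ℕ, q * ν * q ^ k ≠ 1 := fun k => by
    have := hν (k + 1); rwa [pow_succ', ← mul_assoc, mul_comm ν] at this
  have h1 : (1 : ℂ) - ν ≠ 0 := sub_ne_zero.2 (by simpa using (hν 0).symm)
  have e1 : i + 1 + (j + 1) = (i + j + 1) + 1 := by ring
  have e2 : i + (j + 1) = i + j + 1 := by ring
  have e3 : i + 1 + j = i + j + 1 := by ring
  have hq1 : ∀ n, (1 : ℂ) - q * q ^ n ≠ 0 := fun n => sub_ne_zero.2 (by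
    rw [← pow_succ']; exact (hq _ (by omega)).symm)
  simp only [splitWeight, e1, e2, e3]
  rw [qPoch_succ' ν, homPoch_succ' q μ ν, homPoch_succ q μ (q * ν) i, qPoch_succ μ q j,
    qPoch_succ q q (i + j + 1), qPoch_succ q q i, qPoch_succ q q j]
  have a1 := qPoch_ne_zero hν' (i + j + 1)
  have a2 := qPoch_self_ne_zero hq (i + j + 1)
  have a3 := qPoch_self_ne_zero hq i
  have a4 := qPoch_self_ne_zero hq j
  have a5 := hq1 i
  have a6 := hq1 j
  field_simp
  ring

lemma splitWeight_zero_succ {q μ ν : ℂ} (hq : ∀ k : ℕ, 1 ≤ k → q ^ k ≠ 1) (j : ℕ) :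
    splitWeight q μ ν 0 (j + 1) =
      splitWeight q μ (q * ν) 0 j * ((1 - μ * q ^ j) / (1 - ν)) := by
  have a1 := qPoch_self_ne_zero hq (j + 1)
  have a2 := qPoch_self_ne_zero hq j
  simp only [splitWeight, zero_add, homPoch_zero, qPoch_zero, one_mul]
  rw [div_self a1, div_self a2, qPoch_succ' ν, qPoch_succ μ, mul_one, mul_one, div_mul_div_comm,
    mul_comm (1 - ν)]

lemma splitWeight_succ_zero {q μ ν : ℂ} (hq : ∀ k : ℕ, 1 ≤ k → q ^ k ≠ 1) (i : ℕ) :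
    splitWeight q μ ν (i + 1) 0 =
      splitWeight q μ (q * ν) i 0 * ((μ * q ^ 0 - ν) / (1 - ν)) := by
  have a1 := qPoch_self_ne_zero hq (i + 1)
  have a2 := qPoch_self_ne_zero hq i
  simp only [splitWeight, add_zero, qPoch_zero, mul_one]
  rw [div_self a1, div_self a2, qPoch_succ' ν, homPoch_succ', mul_one, mul_one, div_mul_div_comm,
    mul_comm (1 - ν), pow_zero, mul_one, mul_comm (μ - ν)]

/-- The binomial theorem in the quantum plane. -/
lemma planeLine_pow_eq_sum {E : Type*} [Ring E] [Algebra ℂ E] {q μ ν : ℂ} {A B : E}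
    (hq : ∀ k : ℕ, 1 ≤ k → q ^ k ≠ 1) (hν : ∀ k : ℕ, ν * q ^ k ≠ 1)
    (h : A * B = q • (B * A)) (n : ℕ) :
    planeLine A B μ ^ n = ∑ ij ∈ Finset.HasAntidiagonal.antidiagonal n,
      splitWeight q μ ν ij.1 ij.2 • (planeLine A B 1 ^ ij.1 * planeLine A B ν ^ ij.2) := by
  induction n generalizing ν with
  | zero => simp [splitWeight, homPoch_zero, qPoch_zero]
  | succ n ih =>
    have hν' : ∀ k : ℕ, q * ν * q ^ k ≠ 1 := fun k => by
      have := hν (k + 1); rwa [pow_succ', ← mul_assoc, mul_comm ν] at this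
    have h1 : (1 : ℂ) - ν ≠ 0 := sub_ne_zero.2 (by simpa using (hν 0).symm)
    -- As `ν ≠ 1`, every `c` is an affine combination of `1` and `ν`.
    have split : ∀ c : ℂ, planeLine A B c = ((c - ν) / (1 - ν)) • planeLine A B 1
        + ((1 - c) / (1 - ν)) • planeLine A B ν := fun c => by
      simp only [planeLine, smul_sub, smul_smul]
      match_scalars <;> field_simp <;> ring
    -- `P` and `Q` collect the contributions of the new factor along `A - B` and along `A - ν B`,
    -- indexed by the resulting exponents; the value `0` stands for exponents that do not arise.
    let P : ℕ → ℕ → ℂ := fun i j => match i with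
      | 0 => 0
      | i + 1 => splitWeight q μ (q * ν) i j * ((μ * q ^ j - ν) / (1 - ν))
    let Q : ℕ → ℕ → ℂ := fun i j => match j with
      | 0 => 0
      | j + 1 => splitWeight q μ (q * ν) i j * ((1 - μ * q ^ j) / (1 - ν))
    have hPQ : ∀ ij ∈ Finset.HasAntidiagonal.antidiagonal (n + 1),
        splitWeight q μ ν ij.1 ij.2 • (planeLine A B 1 ^ ij.1 * planeLine A B ν ^ ij.2)
        = P ij.1 ij.2 • (planeLine A B 1 ^ ij.1 * planeLine A B ν ^ ij.2)
        + Q ij.1 ij.2 • (planeLine A B 1 ^ ij.1 * planeLine A B ν ^ ij.2) := by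
      rintro ⟨i, j⟩ hij
      rw [← add_smul]
      congr 1
      rcases i with _ | i <;> rcases j with _ | j
      · simp at hij
      · simpa [P, Q] using splitWeight_zero_succ hq j
      · simpa [P, Q] using splitWeight_succ_zero hq i
      · exact splitWeight_succ_succ hq hν i j
    rw [Finset.sum_congr rfl hPQ, Finset.sum_add_distrib, Finset.Nat.sum_antidiagonal_succ,
      Finset.Nat.sum_antidiagonal_succ' (n := n)]
    simp only [P, Q, zero_smul, zero_add]
    -- The `n`-th power is expanded with `q ν` instead of `ν`: moving `A - μ B` to the left through
    -- `(A - q ν B)^j` turns these factors into `A - ν B` and itself into `A - μ q^j B`.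
    rw [← Finset.sum_add_distrib, pow_succ, ih hν', Finset.sum_mul]
    refine Finset.sum_congr rfl fun ij _ => ?_
    rw [smul_mul_assoc, mul_assoc, planeLine_pow_mul h, split (μ * q ^ ij.2)]
    simp only [add_mul, mul_add, smul_mul_assoc, mul_smul_comm, smul_add, smul_smul]
    simp only [pow_succ (planeLine A B 1), pow_succ' (planeLine A B ν), mul_assoc]

lemma planeLine_pow_eq_sum_phi {E : Type*} [Ring E] [Algebra ℂ E] {q μ ν : ℂ} {A B : E}
    (hq : ∀ k : ℕ, 1 ≤ k → q ^ k ≠ 1) (hν : ∀ k : ℕ, ν * q ^ k ≠ 1) (hμ : μ = 0 → ν = 0)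
    (h : A * B = q • (B * A)) (n : ℕ) :
    ∑ m ∈ Finset.range (n + 1),
      phi q μ ν m n • (planeLine A B 1 ^ m * planeLine A B ν ^ (n - m)) =
      planeLine A B μ ^ n := by
  rw [planeLine_pow_eq_sum hq hν h, Finset.Nat.sum_antidiagonal_eq_sum_range_succ
    (fun i j => splitWeight q μ ν i j • (planeLine A B 1 ^ i * planeLine A B ν ^ j))]
  refine Finset.sum_congr rfl fun m hm => ?_
  rw [phi_eq_splitWeight hμ (by simpa [Nat.lt_succ_iff] using hm)]

/-- The binomial theorem at `A = 1`, `B = 0`. -/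
lemma sum_phi {q μ ν : ℂ} (hq : ∀ k : ℕ, 1 ≤ k → q ^ k ≠ 1) (hν : ∀ k : ℕ, ν * q ^ k ≠ 1)
    (hμ : μ = 0 → ν = 0) (n : ℕ) : ∑ m ∈ Finset.range (n + 1), phi q μ ν m n = 1 := by
  have := planeLine_pow_eq_sum_phi (E := ℂ) (A := 1) (B := 0) hq hν hμ (by simp) n
  simpa [planeLine] using this

lemma siteWeight_ne_zero {q ν : ℂ} (hq : ∀ k : ℕ, 1 ≤ k → q ^ k ≠ 1)
    (hν : ∀ k : ℕ, ν * q ^ k ≠ 1) (n : ℕ) : siteWeight q ν n ≠ 0 :=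
  div_ne_zero (qPoch_ne_zero hν n) (qPoch_self_ne_zero hq n)

lemma siteWeight_zero (q ν : ℂ) : siteWeight q ν 0 = 1 := by
  simp [siteWeight, qPoch_zero]

/-- The factor `f(n)` cancels the only part of `φ(m|n)` depending on `n` itself, which leaves
independent weights for the moving and the staying particles. -/
lemma phi_mul_siteWeight {q μ ν : ℂ} (hq : ∀ k : ℕ, 1 ≤ k → q ^ k ≠ 1)
    (hν : ∀ k : ℕ, ν * q ^ k ≠ 1) (hμ : μ = 0 → ν = 0) {m n : ℕ} (hmn : m ≤ n) :
    phi q μ ν m n * siteWeight q ν n =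
      (homPoch q μ ν m / qPoch q q m) * (qPoch μ q (n - m) / qPoch q q (n - m)) := by
  rw [phi_eq_splitWeight hμ hmn, splitWeight, siteWeight, Nat.add_sub_cancel' hmn]
  have a1 := qPoch_ne_zero hν n
  have a2 := qPoch_self_ne_zero hq n
  field_simp

/-! ### Operators adding labels on the left and on the right -/

section Fock

variable {N : ℕ}

/-- The exchange factor of the labels `a` and `b`. -/
noncomputable def exchange (q : ℂ) (u : Fin N → ℂ) (a b : Fin N) : ℂ :=
  (if a < b then 1 else -1) * (u a - q * u b)

lemma exchange_ne_zero {q : ℂ} {u : Fin N → ℂ} (hu : ∀ i j, i ≠ j → u i ≠ q * u j)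
    {a b : Fin N} (hab : a ≠ b) : exchange q u a b ≠ 0 := by
  unfold exchange
  refine mul_ne_zero ?_ (sub_ne_zero.2 (hu a b hab))
  split_ifs <;> norm_num

lemma exchange_swap {q : ℂ} {u : Fin N → ℂ} {a b : Fin N} (hab : a ≠ b) :
    exchange q u b a = (if a < b then 1 else -1) * (-(u b - q * u a)) := by
  unfold exchange
  rcases lt_or_gt_of_ne hab with h | h
  · rw [if_neg (not_lt.2 h.le), if_pos h]; ring
  · rw [if_pos h, if_neg (not_lt.2 h.le)]; ring

/-- The operator that adds a label on the left of the labels already present, with amplitude `f`. -/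
noncomputable def addLeft (q : ℂ) (u f : Fin N → ℂ) : Module.End ℂ (Finset (Fin N) → ℂ) where
  toFun ψ := fun S => ∑ b ∈ S, f b * (∏ a ∈ S.erase b, exchange q u b a) * ψ (S.erase b)
  map_add' ψ χ := by
    ext S
    simp [mul_add, Finset.sum_add_distrib]
  map_smul' c ψ := by
    ext S
    simp only [Pi.smul_apply, smul_eq_mul, RingHom.id_apply, Finset.mul_sum]
    exact Finset.sum_congr rfl fun b _ => by ring

/-- The operator that adds a label on the right of the labels already present, with
amplitude `f`. -/
noncomputable def addRight (q : ℂ) (u f : Fin N → ℂ) : Module.End ℂ (Finset (Fin N) → ℂ) where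
  toFun ψ := fun S => ∑ b ∈ S, f b * (∏ a ∈ S.erase b, exchange q u a b) * ψ (S.erase b)
  map_add' ψ χ := by
    ext S
    simp [mul_add, Finset.sum_add_distrib]
  map_smul' c ψ := by
    ext S
    simp only [Pi.smul_apply, smul_eq_mul, RingHom.id_apply, Finset.mul_sum]
    exact Finset.sum_congr rfl fun b _ => by ring

/-- The diagonal operator `∏_{a ∈ S} lam a`. -/
noncomputable def diagOp (lam : Fin N → ℂ) : Module.End ℂ (Finset (Fin N) → ℂ) where
  toFun ψ := fun S => (∏ a ∈ S, lam a) * ψ S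
  map_add' ψ χ := by
    ext S
    simp [mul_add]
  map_smul' c ψ := by
    ext S
    simp only [Pi.smul_apply, smul_eq_mul, RingHom.id_apply]
    ring

/-- The state without labels. -/
noncomputable def vacuum (N : ℕ) : Finset (Fin N) → ℂ := Pi.single ∅ 1

lemma addLeft_apply (q : ℂ) (u f : Fin N → ℂ) (ψ : Finset (Fin N) → ℂ) (S : Finset (Fin N)) :
    addLeft q u f ψ S = ∑ b ∈ S, f b * (∏ a ∈ S.erase b, exchange q u b a) * ψ (S.erase b) := rfl

lemma addRight_apply (q : ℂ) (u f : Fin N → ℂ) (ψ : Finset (Fin N) → ℂ) (S : Finset (Fin N)) :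
    addRight q u f ψ S = ∑ b ∈ S, f b * (∏ a ∈ S.erase b, exchange q u a b) * ψ (S.erase b) := rfl

lemma diagOp_apply (lam : Fin N → ℂ) (ψ : Finset (Fin N) → ℂ) (S : Finset (Fin N)) :
    diagOp lam ψ S = (∏ a ∈ S, lam a) * ψ S := rfl

lemma planeLine_addLeft (q : ℂ) (u f g : Fin N → ℂ) (c : ℂ) :
    planeLine (addLeft q u f) (addLeft q u g) c = addLeft q u (fun a => f a - c * g a) := by
  refine LinearMap.ext fun ψ => funext fun S => ?_
  simp only [planeLine, LinearMap.sub_apply, LinearMap.smul_apply, Pi.sub_apply, Pi.smul_apply,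
    addLeft_apply, smul_eq_mul, Finset.mul_sum, ← Finset.sum_sub_distrib]
  exact Finset.sum_congr rfl fun b _ => by ring

/-- If `b` is added on the left and `c` on the right, the pair contributes `exchange q u b c` in
either order of the operations. -/
lemma commute_addLeft_addRight (q : ℂ) (u f g : Fin N → ℂ) :
    Commute (addLeft q u f) (addRight q u g) := by
  change _ * _ = _ * _
  refine LinearMap.ext fun ψ => funext fun S => ?_
  simp only [Module.End.mul_apply, addLeft_apply, addRight_apply, Finset.mul_sum]
  rw [Finset.sum_comm' (t' := S) (s' := fun c => S.erase c)
    (by intro x y; simp only [Finset.mem_erase]; tauto)]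
  refine Finset.sum_congr rfl fun c hc => Finset.sum_congr rfl fun b hb => ?_
  have hb' := Finset.mem_erase.1 hb
  rw [← Finset.mul_prod_erase (S.erase b) (fun a => exchange q u b a)
      (Finset.mem_erase.2 ⟨hb'.1.symm, hc⟩),
    ← Finset.mul_prod_erase (S.erase c) (fun a => exchange q u a c) hb,
    Finset.erase_right_comm]
  ring

/-- For added labels `b` and `c`, the difference of both sides is a symmetric factor times `exchange
q u b c * (u c - q * u b)`. The latter is antisymmetric, so the sum over ordered pairs is its own
negative. -/
lemma addLeft_quantum_plane (q : ℂ) (u h : Fin N → ℂ) :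
    addLeft q u h * addLeft q u (fun a => h a * u a) =
      q • (addLeft q u (fun a => h a * u a) * addLeft q u h) := by
  refine LinearMap.ext fun ψ => funext fun S => ?_
  simp only [Module.End.mul_apply, LinearMap.smul_apply, Pi.smul_apply, smul_eq_mul,
    addLeft_apply, Finset.mul_sum]
  rw [← sub_eq_zero, ← Finset.sum_sub_distrib]
  simp only [← Finset.sum_sub_distrib]
  have key : ∀ X : ℂ, X = -X → X = 0 := fun X hX => by linear_combination hX / 2
  apply key
  rw [← Finset.sum_neg_distrib]
  simp only [← Finset.sum_neg_distrib]
  nth_rewrite 1 [Finset.sum_comm' (t' := S) (s' := fun c => S.erase c)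
    (by intro x y; simp only [Finset.mem_erase]; tauto)]
  refine Finset.sum_congr rfl fun c hc => Finset.sum_congr rfl fun b hb => ?_
  have hb' := Finset.mem_erase.1 hb
  rw [← Finset.mul_prod_erase (S.erase b) (fun a => exchange q u b a)
      (Finset.mem_erase.2 ⟨hb'.1.symm, hc⟩),
    ← Finset.mul_prod_erase (S.erase c) (fun a => exchange q u c a) hb,
    Finset.erase_right_comm, exchange_swap hb'.1, exchange]
  ring

lemma diagOp_mul_addLeft (q : ℂ) (u f lam : Fin N → ℂ) :
    diagOp lam * addLeft q u f = addLeft q u (fun a => f a * lam a) * diagOp lam := by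
  refine LinearMap.ext fun ψ => funext fun S => ?_
  simp only [Module.End.mul_apply, diagOp_apply, addLeft_apply, Finset.mul_sum]
  refine Finset.sum_congr rfl fun b hb => ?_
  rw [← Finset.mul_prod_erase S lam hb]
  ring

lemma diagOp_vacuum (lam : Fin N → ℂ) : diagOp lam (vacuum N) = vacuum N := by
  ext S
  rw [diagOp_apply]
  by_cases h : S = ∅
  · simp [h]
  · simp [vacuum, h]

lemma addLeft_vacuum (q : ℂ) (u f : Fin N → ℂ) :
    addLeft q u f (vacuum N) = addRight q u f (vacuum N) := by
  ext S
  rw [addLeft_apply, addRight_apply]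
  refine Finset.sum_congr rfl fun b hb => ?_
  by_cases h : S.erase b = ∅
  · simp [h]
  · simp [vacuum, h]

/-- The component of the state `w vacuum` in which all labels are present. -/
noncomputable def fullComponent : Module.End ℂ (Finset (Fin N) → ℂ) →ₗ[ℂ] ℂ :=
  LinearMap.proj Finset.univ ∘ₗ LinearMap.applyₗ (vacuum N)

lemma fullComponent_apply (w : Module.End ℂ (Finset (Fin N) → ℂ)) :
    fullComponent w = w (vacuum N) Finset.univ := rfl

lemma list_prod_addLeft_apply (q : ℂ) (u : Fin N → ℂ) {k : ℕ} (f : Fin k → Fin N → ℂ)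
    (S : Finset (Fin N)) :
    (List.ofFn fun i => addLeft q u (f i)).prod (vacuum N) S =
      ∑ g : Fin k → Fin N, if Function.Injective g ∧ Finset.univ.image g = S then
        (∏ i, ∏ j ∈ Finset.Ioi i, exchange q u (g i) (g j)) * ∏ i, f i (g i) else 0 := by
  induction k generalizing S with
  | zero =>
    simp [vacuum, Pi.single_apply, eq_comm, Function.injective_of_subsingleton]
  | succ k ih =>
    rw [List.ofFn_succ, List.prod_cons, Module.End.mul_apply, addLeft_apply]
    simp only [ih]
    rw [← (Fin.consEquiv fun _ => Fin N).sum_comp, Fintype.sum_prod_type,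
      ← Finset.sum_subset (Finset.subset_univ S)]
    · refine Finset.sum_congr rfl fun b hb => ?_
      rw [Finset.mul_sum]
      refine Finset.sum_congr rfl fun g _ => ?_
      have hiff : (Function.Injective (Fin.cons b g : Fin (k + 1) → Fin N) ∧
          Finset.univ.image (Fin.cons b g : Fin (k + 1) → Fin N) = S) ↔
          (Function.Injective g ∧ Finset.univ.image g = S.erase b) := by
        rw [Fin.cons_injective_iff]
        have : Finset.univ.image (Fin.cons b g : Fin (k + 1) → Fin N)
            = insert b (Finset.univ.image g) := by
          ext a
          simp [Fin.exists_fin_succ, eq_comm]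
        rw [this]
        constructor
        · rintro ⟨⟨h1, h2⟩, rfl⟩
          refine ⟨h2, ?_⟩
          rw [Finset.erase_insert]
          simpa using h1
        · rintro ⟨h1, h2⟩
          refine ⟨⟨?_, h1⟩, ?_⟩
          · intro h
            have : b ∈ Finset.univ.image g := by simpa using h
            rw [h2] at this
            simp at this
          · rw [h2, Finset.insert_erase hb]
      change _ = if Function.Injective (Fin.cons b g : Fin (k + 1) → Fin N) ∧
          Finset.univ.image (Fin.cons b g : Fin (k + 1) → Fin N) = S then
        (∏ i, ∏ j ∈ Finset.Ioi i, exchange q u ((Fin.cons b g : Fin (k + 1) → Fin N) i)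
          ((Fin.cons b g : Fin (k + 1) → Fin N) j)) *
          ∏ i, f i ((Fin.cons b g : Fin (k + 1) → Fin N) i) else 0
      simp only [hiff]
      split_ifs with h
      · rw [← h.2, Finset.prod_image (fun _ _ _ _ e => h.1 e), Fin.prod_univ_succ,
          Fin.prod_univ_succ, Fin.prod_Ioi_zero]
        simp only [Fin.prod_Ioi_succ, Fin.cons_zero, Fin.cons_succ]
        ring
      · simp
    · intro b _ hb
      refine Finset.sum_eq_zero fun g _ => if_neg ?_
      rintro ⟨-, h⟩
      apply hb
      rw [← h]
      exact Finset.mem_image.2 ⟨0, Finset.mem_univ _, rfl⟩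

/-- Only words using every label exactly once reach the full set, and these are the permutations;
the signs of the exchange factors multiply to the sign of the permutation. -/
lemma fullComponent_ofFn (q : ℂ) (u : Fin N → ℂ) (f : Fin N → Fin N → ℂ) :
    fullComponent (List.ofFn fun i => addLeft q u (f i)).prod =
      ∑ σ : Equiv.Perm (Fin N), ((Equiv.Perm.sign σ : ℤ) : ℂ) *
        (∏ i, ∏ j ∈ Finset.Ioi i, (u (σ i) - q * u (σ j))) * ∏ i, f i (σ i) := by
  rw [fullComponent_apply, list_prod_addLeft_apply, ← Finset.sum_filter]
  symm
  refine Finset.sum_bij (fun σ _ => σ) ?_ ?_ ?_ ?_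
  · intro σ _
    simp only [Finset.mem_filter, Finset.mem_univ, true_and]
    exact ⟨σ.injective, Finset.image_univ_of_surjective σ.surjective⟩
  · intro σ _ τ _ h
    exact DFunLike.coe_injective h
  · intro g hg
    simp only [Finset.mem_filter, Finset.mem_univ, true_and] at hg
    exact ⟨Equiv.ofBijective g (Finite.injective_iff_bijective.1 hg.1), Finset.mem_univ _, rfl⟩
  · intro σ _
    congr 1
    rw [Equiv.Perm.sign_eq_prod_prod_Ioi]
    simp only [exchange, Finset.prod_mul_distrib]
    congr 1
    push_cast
    refine Finset.prod_congr rfl fun i _ => Finset.prod_congr rfl fun j _ => ?_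
    split_ifs <;> simp

end Fock

/-! ### A partial fraction identity -/

section Interpolation

open Polynomial

/-- A partial fraction identity of Lagrange type. -/
lemma sum_prod_sub_div_sub {ι : Type*} [DecidableEq ι] (q : ℂ) (u : ι → ℂ) (S : Finset ι)
    (hS : Set.InjOn u S) :
    ∑ b ∈ S, (1 - q) * ((∏ a ∈ S.erase b, (u b - q * u a)) / ∏ a ∈ S.erase b, (u b - u a)) =
      1 - q ^ S.card := by
  let P : Finset ι → ℂ[X] := fun T => ∏ a ∈ T, (X - C (q * u a))
  let R : Finset ι → ℂ[X] := fun T => ∏ a ∈ T, (X - C (u a))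
  -- `F T` vanishes at `0`. The polynomial `F S / X` has degree below `S.card`, and its coefficient
  -- of degree `S.card - 1` is `1 - q ^ S.card`; Lagrange interpolation at the `u b` expresses this
  -- coefficient by values.
  let F : Finset ι → ℂ[X] := fun T => P T - C (q ^ T.card) * R T
  have hP1 : ∀ T, (P T).natDegree = T.card := fun T => by
    rw [natDegree_prod_of_monic _ _ fun a _ => monic_X_sub_C (q * u a)]
    simp only [natDegree_X_sub_C, Finset.sum_const, smul_eq_mul, mul_one]
  have hR1 : ∀ T, (R T).natDegree = T.card := fun T => by
    rw [natDegree_prod_of_monic _ _ fun a _ => monic_X_sub_C (u a)]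
    simp only [natDegree_X_sub_C, Finset.sum_const, smul_eq_mul, mul_one]
  have hPm : ∀ T, (P T).Monic := fun T => monic_prod_of_monic _ _ fun a _ => monic_X_sub_C _
  have hRm : ∀ T, (R T).Monic := fun T => monic_prod_of_monic _ _ fun a _ => monic_X_sub_C _
  have hF0 : ∀ T, (F T).coeff 0 = 0 := fun T => by
    rw [coeff_zero_eq_eval_zero]
    simp only [F, P, R, eval_sub, eval_mul, eval_prod, eval_X, eval_C, zero_sub]
    rw [sub_eq_zero, ← Finset.prod_const, ← Finset.prod_mul_distrib]
    exact Finset.prod_congr rfl fun a _ => by ring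
  have hF : ∀ T, (F T).divX * X = F T := fun T => by
    have := divX_mul_X_add (F T)
    rwa [hF0, C_0, add_zero] at this
  have hFdeg : ∀ T, (F T).natDegree ≤ T.card := fun T => by
    refine (natDegree_sub_le _ _).trans (max_le (hP1 T).le ?_)
    exact (natDegree_C_mul_le _ _).trans (hR1 T).le
  rcases S.eq_empty_or_nonempty with rfl | hne
  · simp
  have hcard : 1 ≤ S.card := hne.card_pos
  have hdeg : (F S).divX.degree < S.card := by
    rw [degree_lt_iff_coeff_zero]
    intro m hm
    rw [coeff_divX]
    exact coeff_eq_zero_of_natDegree_lt (lt_of_le_of_lt (hFdeg S) (by omega))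
  have h := Lagrange.coeff_eq_sum hS hdeg
  rw [coeff_divX, Nat.sub_add_cancel hcard] at h
  have hc : (F S).coeff S.card = 1 - q ^ S.card := by
    simp only [F, coeff_sub, coeff_C_mul]
    have h1 := (hPm S).coeff_natDegree
    have h2 := (hRm S).coeff_natDegree
    rw [hP1] at h1
    rw [hR1] at h2
    rw [h1, h2, mul_one]
  rw [← hc, h]
  refine Finset.sum_congr rfl fun b hb => ?_
  rw [← mul_div_assoc]
  congr 1
  have hPb : P S = (X - C (q * u b)) * P (S.erase b) := (Finset.mul_prod_erase S _ hb).symm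
  have hRb : R S = (X - C (u b)) * R (S.erase b) := (Finset.mul_prod_erase S _ hb).symm
  have hcb : S.card = (S.erase b).card + 1 := (Finset.card_erase_add_one hb).symm
  -- As `u b` may be `0`, the value of `F S / X` at `u b` cannot be found by dividing values; the
  -- division is performed on polynomials.
  have hQ : (F S).divX = P (S.erase b) - C (q ^ S.card) * R (S.erase b)
      - C (q * u b) * (F (S.erase b)).divX := by
    apply mul_right_cancel₀ (X_ne_zero (R := ℂ))
    rw [hF, sub_mul, mul_assoc (C (q * u b)), hF]
    simp only [F]
    rw [hPb, hRb, hcb, pow_succ]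
    simp only [C_mul]
    ring
  have h3 := congrArg (eval (u b)) (hF (S.erase b))
  rw [eval_mul, eval_X] at h3
  rw [hQ]
  simp only [eval_sub, eval_mul, eval_C, mul_assoc]
  rw [mul_comm (u b), h3]
  simp only [F, eval_sub, eval_mul, eval_C]
  have h4 : eval (u b) (P (S.erase b)) = ∏ a ∈ S.erase b, (u b - q * u a) := by
    simp [P, eval_prod]
  rw [h4, hcb, pow_succ]
  ring

end Interpolation

/-! ### Coinciding particles and the Vandermonde product -/

section Nonvanishing

variable {N : ℕ}

/-- The Vandermonde product of the variables with labels in `S`. -/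
noncomputable def vandermondeOn (u : Fin N → ℂ) (S : Finset (Fin N)) : ℂ :=
  ∏ a ∈ S, ∏ b ∈ S, if a < b then u a - u b else 1

lemma vandermondeOn_ne_zero {u : Fin N → ℂ} (hu : Function.Injective u) (S : Finset (Fin N)) :
    vandermondeOn u S ≠ 0 := by
  refine Finset.prod_ne_zero_iff.2 fun a _ => Finset.prod_ne_zero_iff.2 fun b _ => ?_
  split_ifs with h
  · exact sub_ne_zero.2 fun e => h.ne (hu e)
  · exact one_ne_zero

lemma vandermondeOn_eq_erase (u : Fin N → ℂ) {S : Finset (Fin N)} {b : Fin N} (hb : b ∈ S) :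
    vandermondeOn u S = (∏ a ∈ S.erase b, (if b < a then 1 else -1) * (u b - u a)) *
      vandermondeOn u (S.erase b) := by
  unfold vandermondeOn
  rw [← Finset.mul_prod_erase S _ hb]
  simp only [← Finset.mul_prod_erase S (fun c => if _ < c then _ else (1 : ℂ)) hb]
  rw [if_neg (lt_irrefl b), one_mul, Finset.prod_mul_distrib, ← mul_assoc,
    ← Finset.prod_mul_distrib]
  congr 1
  refine Finset.prod_congr rfl fun a ha => ?_
  rcases lt_or_gt_of_ne (Finset.ne_of_mem_erase ha) with h | h
  · rw [if_neg (not_lt.2 h.le), if_pos h, if_neg (not_lt.2 h.le)]; ring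
  · rw [if_pos h, if_neg (not_lt.2 h.le), if_pos h]; ring

/-- Splitting the Vandermonde product at the label added last leaves the sum of the partial fraction
identity, so step `k` contributes `(1 - q ^ k) / (1 - q)`. -/
lemma addLeft_one_pow_vacuum {q : ℂ} (hq : q ≠ 1) {u : Fin N → ℂ} (hu : Function.Injective u)
    (k : ℕ) (S : Finset (Fin N)) (hS : S.card = k) :
    (addLeft q u (fun _ => 1) ^ k) (vacuum N) S =
      qPoch q q k / (1 - q) ^ k * vandermondeOn u S := by
  have hq' : (1 : ℂ) - q ≠ 0 := sub_ne_zero.2 hq.symm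
  induction k generalizing S with
  | zero =>
    obtain rfl := Finset.card_eq_zero.1 hS
    simp [vacuum, vandermondeOn, qPoch_zero]
  | succ k ih =>
    rw [pow_succ', Module.End.mul_apply, addLeft_apply]
    have : ∀ b ∈ S, 1 * (∏ a ∈ S.erase b, exchange q u b a) *
        (addLeft q u (fun _ => 1) ^ k) (vacuum N) (S.erase b) =
        qPoch q q k / (1 - q) ^ (k + 1) * vandermondeOn u S * ((1 - q) *
          ((∏ a ∈ S.erase b, (u b - q * u a)) / ∏ a ∈ S.erase b, (u b - u a))) := by
      intro b hb
      rw [ih _ (by rw [Finset.card_erase_of_mem hb, hS]; rfl), vandermondeOn_eq_erase u hb]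
      simp only [exchange, Finset.prod_mul_distrib]
      have : ∏ a ∈ S.erase b, (u b - u a) ≠ 0 := Finset.prod_ne_zero_iff.2 fun a ha =>
        sub_ne_zero.2 fun e => Finset.ne_of_mem_erase ha (hu e).symm
      field_simp
      ring
    rw [Finset.sum_congr rfl this, ← Finset.mul_sum, sum_prod_sub_div_sub q u S hu.injOn, hS,
      qPoch_succ, pow_succ' q]
    ring

end Nonvanishing

/-! ### The Bethe function as a word; Bethe equations as cyclicity -/

section BetheWords

variable {N : ℕ}

/-- The operator of a particle at the coordinate `x`. -/
noncomputable def particle (q ν : ℂ) (u : Fin N → ℂ) (x : ℤ) :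
    Module.End ℂ (Finset (Fin N) → ℂ) :=
  addLeft q u fun a => ((1 - ν * u a) / (1 - u a)) ^ x

lemma betheFn_eq_fullComponent (q ν : ℂ) (u : Fin N → ℂ) (x : Fin N → ℤ) :
    betheFn q ν u x = (∏ i, ∏ j ∈ Finset.Ioi i, (u i - q * u j))⁻¹ *
      fullComponent (List.ofFn fun i => particle q ν u (x i)).prod := by
  unfold particle
  rw [fullComponent_ofFn, betheFn, Finset.mul_sum]
  refine Finset.sum_congr rfl fun σ _ => ?_
  simp only [Finset.prod_div_distrib]
  ring

/-- The operator of a particle at the coordinate `x`, multiplied by its one-particle eigenvalue. -/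
noncomputable def dressedParticle (q μ ν : ℂ) (u : Fin N → ℂ) (x : ℤ) :
    Module.End ℂ (Finset (Fin N) → ℂ) :=
  addLeft q u fun a => ((1 - ν * u a) / (1 - u a)) ^ x * ((1 - μ * u a) / (1 - ν * u a))

lemma sum_phi_particle {q μ ν : ℂ} (hq : ∀ k : ℕ, 1 ≤ k → q ^ k ≠ 1)
    (hν : ∀ k : ℕ, ν * q ^ k ≠ 1) (hμ : μ = 0 → ν = 0) {u : Fin N → ℂ} (hu : ∀ i, u i ≠ 1)
    (hνu : ∀ i, ν * u i ≠ 1) (x : ℤ) (n : ℕ) :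
    ∑ m ∈ Finset.range (n + 1),
      phi q μ ν m n • (particle q ν u (x - 1) ^ m * particle q ν u x ^ (n - m)) =
      dressedParticle q μ ν u x ^ n := by
  have h1 : ∀ a, 1 - u a ≠ 0 := fun a => sub_ne_zero.2 (hu a).symm
  have h2 : ∀ a, 1 - ν * u a ≠ 0 := fun a => sub_ne_zero.2 (hνu a).symm
  -- With this common factor the three amplitudes are `h (1 - u)`, `h (1 - ν u)` and `h (1 - μ u)`.
  let h : Fin N → ℂ := fun a => ((1 - ν * u a) / (1 - u a)) ^ x / (1 - ν * u a)
  have e1 : particle q ν u (x - 1) =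
      planeLine (addLeft q u h) (addLeft q u fun a => h a * u a) 1 := by
    rw [planeLine_addLeft, particle]
    congr 1
    ext a
    rw [zpow_sub_one₀ (div_ne_zero (h2 a) (h1 a))]
    simp only [h]
    have := h1 a
    have := h2 a
    field_simp
  have e2 : particle q ν u x =
      planeLine (addLeft q u h) (addLeft q u fun a => h a * u a) ν := by
    rw [planeLine_addLeft, particle]
    congr 1
    ext a
    simp only [h]
    have := h2 a
    field_simp
  have e3 : dressedParticle q μ ν u x =
      planeLine (addLeft q u h) (addLeft q u fun a => h a * u a) μ := by
    rw [planeLine_addLeft, dressedParticle]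
    congr 1
    ext a
    simp only [h]
    ring
  rw [e1, e2, e3]
  exact planeLine_pow_eq_sum_phi hq hν hμ (addLeft_quantum_plane q u h) n

lemma diagOp_mul_particle (q μ ν : ℂ) (u : Fin N → ℂ) (x : ℤ) :
    diagOp (fun a => (1 - μ * u a) / (1 - ν * u a)) * particle q ν u x =
      dressedParticle q μ ν u x * diagOp (fun a => (1 - μ * u a) / (1 - ν * u a)) :=
  diagOp_mul_addLeft _ _ _ _

lemma apply_vacuum_of_diagOp_mul {lam : Fin N → ℂ} {w w' : Module.End ℂ (Finset (Fin N) → ℂ)}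
    (h : diagOp lam * w = w' * diagOp lam) (S : Finset (Fin N)) :
    w' (vacuum N) S = (∏ a ∈ S, lam a) * w (vacuum N) S := by
  rw [← diagOp_apply, ← Module.End.mul_apply, h, Module.End.mul_apply, diagOp_vacuum]

/-- The exchange form of the Bethe equations. -/
lemma betheEquations_iff {q ν : ℂ} {L : ℕ} {u : Fin N → ℂ}
    (hu : ∀ i j, i ≠ j → u i ≠ q * u j) :
    BetheEquations q ν L u ↔ ∀ b, ((1 - ν * u b) / (1 - u b)) ^ L *
      ∏ a ∈ Finset.univ.erase b, exchange q u a b =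
        ∏ a ∈ Finset.univ.erase b, exchange q u b a := by
  refine forall_congr' fun b => ?_
  have h1 : ∏ a ∈ Finset.univ.erase b, exchange q u a b ≠ 0 :=
    Finset.prod_ne_zero_iff.2 fun a ha => exchange_ne_zero hu (Finset.ne_of_mem_erase ha)
  -- Each of the `N - 1` factors is minus a quotient of exchange factors; this absorbs the sign of
  -- the Bethe equations.
  have h2 : ∏ a ∈ Finset.univ.erase b, (u b - q * u a) / (u a - q * u b) =
      (-1) ^ (N - 1) * ((∏ a ∈ Finset.univ.erase b, exchange q u b a) /
        ∏ a ∈ Finset.univ.erase b, exchange q u a b) := by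
    have hc : (Finset.univ.erase b).card = N - 1 := by
      rw [Finset.card_erase_of_mem (Finset.mem_univ b), Finset.card_univ, Fintype.card_fin]
    rw [← hc, ← Finset.prod_const, ← Finset.prod_div_distrib, ← Finset.prod_mul_distrib]
    refine Finset.prod_congr rfl fun a ha => ?_
    have hab := Finset.ne_of_mem_erase ha
    have h3 : u a - q * u b ≠ 0 := sub_ne_zero.2 (hu a b hab)
    rw [exchange_swap hab.symm, exchange]
    split_ifs <;> field_simp
  rw [h2, ← mul_assoc, ← mul_pow, neg_one_mul, neg_neg, one_pow, one_mul, eq_div_iff h1]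

lemma fullComponent_particle_mul (q ν : ℂ) (u : Fin N → ℂ) (y : ℤ)
    (w : Module.End ℂ (Finset (Fin N) → ℂ)) :
    fullComponent (particle q ν u y * w) = ∑ b, ((1 - ν * u b) / (1 - u b)) ^ y *
      (∏ a ∈ Finset.univ.erase b, exchange q u b a) * w (vacuum N) (Finset.univ.erase b) := rfl

/-- The last letter acts on the vacuum, where it equals a right addition, and can then be commuted
to the front. -/
lemma fullComponent_mul_particle (q ν : ℂ) (u : Fin N → ℂ) (y : ℤ)
    (w : Module.End ℂ (Finset (Fin N) → ℂ)) (hw : ∀ f, Commute w (addRight q u f)) :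
    fullComponent (w * particle q ν u y) = ∑ b, ((1 - ν * u b) / (1 - u b)) ^ y *
      (∏ a ∈ Finset.univ.erase b, exchange q u a b) * w (vacuum N) (Finset.univ.erase b) := by
  rw [fullComponent_apply, Module.End.mul_apply, particle, addLeft_vacuum, ← Module.End.mul_apply,
    (hw _).eq, Module.End.mul_apply, addRight_apply]

lemma fullComponent_cyclic {q ν : ℂ} {L : ℕ} {u : Fin N → ℂ} (hu1 : ∀ i, u i ≠ 1)
    (hνu : ∀ i, ν * u i ≠ 1) (hu : ∀ i j, i ≠ j → u i ≠ q * u j)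
    (hB : BetheEquations q ν L u) (y : ℤ) (w : Module.End ℂ (Finset (Fin N) → ℂ))
    (hw : ∀ f, Commute w (addRight q u f)) :
    fullComponent (particle q ν u y * w) = fullComponent (w * particle q ν u (y + L)) := by
  rw [fullComponent_particle_mul, fullComponent_mul_particle _ _ _ _ _ hw]
  refine Finset.sum_congr rfl fun b _ => ?_
  rw [← (betheEquations_iff hu).1 hB b, zpow_add₀ (div_ne_zero (sub_ne_zero.2 (hνu b).symm)
    (sub_ne_zero.2 (hu1 b).symm)), zpow_natCast]
  ring

lemma fullComponent_cyclic_pow {q ν : ℂ} {L : ℕ} {u : Fin N → ℂ} (hu1 : ∀ i, u i ≠ 1)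
    (hνu : ∀ i, ν * u i ≠ 1) (hu : ∀ i j, i ≠ j → u i ≠ q * u j)
    (hB : BetheEquations q ν L u) (y : ℤ) (p : ℕ) (w : Module.End ℂ (Finset (Fin N) → ℂ))
    (hw : ∀ f, Commute w (addRight q u f)) :
    fullComponent (particle q ν u y ^ p * w) = fullComponent (w * particle q ν u (y + L) ^ p) := by
  have hp : ∀ x f, Commute (particle q ν u x) (addRight q u f) := fun x f =>
    commute_addLeft_addRight _ _ _ _
  induction p generalizing w with
  | zero => simp
  | succ p ih =>
    rw [pow_succ', mul_assoc, fullComponent_cyclic hu1 hνu hu hB _ _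
      fun f => ((hp y f).pow_left p).mul_left (hw f), mul_assoc, ih _
      fun f => (hw f).mul_left (hp _ f), mul_assoc, ← pow_succ']

lemma commute_list_prod_particle (q ν : ℂ) (u : Fin N → ℂ) (f : Fin N → ℂ) (l : List ℤ) :
    Commute (l.map (particle q ν u)).prod (addRight q u f) := by
  induction l with
  | nil => simp
  | cons x l ih =>
    rw [List.map_cons, List.prod_cons]
    exact (commute_addLeft_addRight _ _ _ _).mul_left ih

/-- Periodicity of the Bethe function, in terms of operators. -/
lemma betheFn_ringShift {N : ℕ} (q ν : ℂ) (u : Fin (N + 1) → ℂ) (L : ℕ) (x : Fin (N + 1) → ℤ) :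
    betheFn q ν u (ringShift L x) = (∏ i, ∏ j ∈ Finset.Ioi i, (u i - q * u j))⁻¹ *
      fullComponent ((List.ofFn fun i : Fin N => particle q ν u (x i.succ)).prod *
        particle q ν u (x 0 + L)) := by
  rw [betheFn_eq_fullComponent, List.ofFn_succ', List.concat_eq_append, List.prod_append,
    List.prod_singleton]
  congr 4
  · congr 1
    ext i : 1
    have : ((i.castSucc : Fin (N + 1)) : ℕ) + 1 ≠ N + 1 := by simp [i.isLt.ne]
    rw [ringShift, if_neg this, finRotate_apply, Fin.coeSucc_eq_succ]
  · rw [ringShift, if_pos (by simp), finRotate_last]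

lemma betheFn_periodic {q ν : ℂ} {L : ℕ} {u : Fin N → ℂ} (hu1 : ∀ i, u i ≠ 1)
    (hνu : ∀ i, ν * u i ≠ 1) (hu : ∀ i j, i ≠ j → u i ≠ q * u j)
    (hB : BetheEquations q ν L u) (x : Fin N → ℤ) :
    betheFn q ν u x = betheFn q ν u (ringShift L x) := by
  rcases N with _ | N
  · exact congrArg _ (Subsingleton.elim _ _)
  · rw [betheFn_ringShift, betheFn_eq_fullComponent, List.ofFn_succ, List.prod_cons,
      fullComponent_cyclic hu1 hνu hu hB]
    intro f
    have := commute_list_prod_particle q ν u f (List.ofFn fun i : Fin N => x i.succ)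
    rwa [List.map_ofFn] at this

lemma betheFn_zero_ne_zero {q ν : ℂ} (hq : ∀ k : ℕ, 1 ≤ k → q ^ k ≠ 1) {u : Fin N → ℂ}
    (hu : ∀ i j, i < j → u i ≠ q * u j) (hinj : Function.Injective u) :
    betheFn q ν u (fun _ => 0) ≠ 0 := by
  have hq1 : q ≠ 1 := by simpa using hq 1 le_rfl
  rw [betheFn_eq_fullComponent, List.ofFn_const, List.prod_replicate, fullComponent_apply, particle]
  simp only [zpow_zero]
  rw [addLeft_one_pow_vacuum hq1 hinj N _ (by simp)]
  refine mul_ne_zero (inv_ne_zero ?_) (mul_ne_zero (div_ne_zero (qPoch_self_ne_zero hq N)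
    (pow_ne_zero _ (sub_ne_zero.2 hq1.symm))) (vandermondeOn_ne_zero hinj _))
  exact Finset.prod_ne_zero_iff.2 fun i _ => Finset.prod_ne_zero_iff.2 fun j hj =>
    sub_ne_zero.2 (hu i j (Finset.mem_Ioi.1 hj))

end BetheWords

/-! ### Words grouped by sites -/

section Words

/-- Both lists are sorted and contain every value equally often. -/
lemma ofFn_eq_flatMap_replicate {N : ℕ} {x : Fin N → ℤ} (hx : Monotone x) {a : ℤ} {K : ℕ}
    (hlo : ∀ j, a ≤ x j) (hhi : ∀ j, x j < a + K) :
    List.ofFn x = (List.range K).flatMap fun i : ℕ =>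
      List.replicate (Finset.univ.filter fun j => x j = a + i).card (a + i) := by
  refine List.Perm.eq_of_pairwise (fun b c _ _ h1 h2 => le_antisymm h1 h2)
    hx.sortedLE_ofFn.pairwise ?_ ?_
  · rw [List.pairwise_flatMap]
    refine ⟨fun i _ => List.pairwise_replicate.2 (Or.inr le_rfl), ?_⟩
    refine List.pairwise_lt_range.imp fun {i j} hij b hb c hc => ?_
    rw [List.eq_of_mem_replicate hb, List.eq_of_mem_replicate hc]
    omega
  · rw [List.perm_iff_count]
    intro b
    rw [List.count_flatMap]
    have h1 : List.count b (List.ofFn x) = (Finset.univ.filter fun j => x j = b).card := by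
      rw [← Multiset.coe_count, ← Fin.univ_val_map, Multiset.count_map, Finset.card_def,
        Finset.filter_val]
      congr 1
      exact Multiset.filter_congr fun j _ => eq_comm
    have hsum : ∀ (f : ℕ → ℕ) (K : ℕ), ((List.range K).map f).sum = ∑ i ∈ Finset.range K, f i := by
      intro f K
      induction K with
      | zero => simp
      | succ K ih => simp [List.range_succ, Finset.sum_range_succ, ih]
    rw [h1, hsum]
    simp only [Function.comp_def, List.count_replicate, beq_iff_eq]
    by_cases hb : a ≤ b ∧ b < a + K
    · obtain ⟨i, rfl⟩ : ∃ i : ℕ, b = a + i := ⟨(b - a).toNat, by omega⟩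
      rw [Finset.sum_eq_single i]
      · simp
      · intro k _ hk
        exact if_neg (by omega)
      · intro h
        exact absurd (Finset.mem_range.2 (by omega)) h
    · rw [Finset.sum_eq_zero, Finset.card_eq_zero, Finset.filter_eq_empty_iff]
      · intro j _ hj
        exact hb ⟨hj ▸ hlo j, hj ▸ hhi j⟩
      · intro i hi
        have := Finset.mem_range.1 hi
        exact if_neg (by omega)

lemma prod_ofFn_eq_prod_range {E : Type*} [Monoid E] (D : ℤ → E) {N : ℕ} {x : Fin N → ℤ}
    (hx : Monotone x) {a : ℤ} {K : ℕ} (hlo : ∀ j, a ≤ x j) (hhi : ∀ j, x j < a + K) :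
    (List.ofFn fun j => D (x j)).prod = ((List.range K).map fun i : ℕ =>
      D (a + i) ^ (Finset.univ.filter fun j => x j = a + i).card).prod := by
  have h1 : (List.ofFn fun j => D (x j)) = (List.ofFn x).map D := by
    rw [List.map_ofFn]
    rfl
  rw [h1, ofFn_eq_flatMap_replicate hx hlo hhi, List.map_flatMap, List.flatMap_def,
    List.prod_flatten, List.map_map]
  simp [Function.comp_def]

/-- Moving the `p i` particles from the site `a + i` to the site `a + i - 1`. -/
lemma prod_range_shift {E : Type*} [Monoid E] (D : ℤ → E) (a : ℤ) (p r : ℕ → ℕ) (K : ℕ) :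
    ((List.range (K + 1)).map fun i : ℕ => D (a + i - 1) ^ p i * D (a + i) ^ r i).prod =
      D (a - 1) ^ p 0 * (((List.range K).map fun i : ℕ => D (a + i) ^ (r i + p (i + 1))).prod *
        D (a + K) ^ r K) := by
  induction K with
  | zero => simp
  | succ K ih =>
    rw [List.range_succ, List.map_append, List.prod_append, ih, List.range_succ (n := K)]
    have : a + ((K + 1 : ℕ) : ℤ) - 1 = a + K := by push_cast; ring
    simp only [List.map_append, List.prod_append, List.map_cons, List.map_nil, List.prod_cons,
      List.prod_nil, mul_one, pow_add, this, mul_assoc]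

lemma sum_piFinset_prod_ofFn {E : Type*} [Semiring E] {K : ℕ} (t : Fin K → Finset ℕ)
    (f : Fin K → ℕ → E) :
    ∑ g ∈ Fintype.piFinset t, (List.ofFn fun i => f i (g i)).prod =
      (List.ofFn fun i => ∑ m ∈ t i, f i m).prod := by
  induction K with
  | zero => simp
  | succ K ih =>
    rw [List.ofFn_succ, List.prod_cons, ← ih, Finset.sum_mul_sum, ← Finset.sum_product']
    refine Finset.sum_bij' (fun g _ => (g 0, Fin.tail g))
      (fun y _ => (Fin.cons y.1 y.2 : Fin (K + 1) → ℕ)) ?_ ?_ ?_ ?_ ?_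
    · intro g hg
      rw [Fintype.mem_piFinset] at hg
      exact Finset.mem_product.2 ⟨hg 0, Fintype.mem_piFinset.2 fun i => hg i.succ⟩
    · intro y hy
      have hy := Finset.mem_product.1 hy
      refine Fintype.mem_piFinset.2 fun i => ?_
      refine Fin.cases ?_ (fun j => ?_) i
      · exact hy.1
      · exact Fintype.mem_piFinset.1 hy.2 j
    · intro g _
      exact Fin.cons_self_tail g
    · intro y _
      simp
    · intro g _
      simp [List.ofFn_succ, Fin.tail]

end Words

/-! ### Periodicity implies the Bethe equations -/

section Necessity

lemma prod_ofFn_ite {E : Type*} [Monoid E] (X Y : E) {m n : ℕ} (h : m ≤ n) :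
    (List.ofFn fun j : Fin n => if (j : ℕ) < m then X else Y).prod = X ^ m * Y ^ (n - m) := by
  obtain ⟨k, rfl⟩ := Nat.exists_eq_add_of_le h
  rw [List.ofFn_add, List.prod_append, Nat.add_sub_cancel_left]
  simp [List.ofFn_const]

lemma betheEquations_of_periodic {q ν : ℂ} (hq : ∀ k : ℕ, 1 ≤ k → q ^ k ≠ 1)
    (hν : ∀ k : ℕ, ν * q ^ k ≠ 1) {N L : ℕ} (hL : 1 ≤ L) {u : Fin N → ℂ} (hu1 : ∀ i, u i ≠ 1)
    (hνu : ∀ i, ν * u i ≠ 1) (hu : ∀ i j, i ≠ j → u i ≠ q * u j) (hinj : Function.Injective u)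
    (hper : ∀ x : Fin N → ℤ, Monotone x → (∀ i j, x i ≤ x j + L) →
      betheFn q ν u x = betheFn q ν u (ringShift L x)) :
    BetheEquations q ν L u := by
  rcases N with _ | N
  · intro i
    exact i.elim0
  have hq1 : q ≠ 1 := by simpa using hq 1 le_rfl
  rw [betheEquations_iff hu]
  let z : Fin (N + 1) → ℂ := fun b => (1 - ν * u b) / (1 - u b)
  have hz : ∀ b, z b ≠ 0 := fun b =>
    div_ne_zero (sub_ne_zero.2 (hνu b).symm) (sub_ne_zero.2 (hu1 b).symm)
  -- `X b` is the defect in the Bethe equation of the label `b`.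
  let X : Fin (N + 1) → ℂ := fun b => ∏ a ∈ Finset.univ.erase b, exchange q u b a -
    z b ^ L * ∏ a ∈ Finset.univ.erase b, exchange q u a b
  have hpref : (∏ i, ∏ j ∈ Finset.Ioi i, (u i - q * u j)) ≠ 0 :=
    Finset.prod_ne_zero_iff.2 fun i _ => Finset.prod_ne_zero_iff.2 fun j hj =>
      sub_ne_zero.2 (hu i j (Finset.mem_Ioi.1 hj).ne)
  have hcomm : ∀ x f, Commute (particle q ν u x) (addRight q u f) := fun x f =>
    commute_addLeft_addRight _ _ _ _
  -- Periodicity with `m + 1` particles at `-1` and `N - m` at `0`, which is in the physical domain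
  -- because `1 ≤ L`.
  have hword : ∀ m ≤ N, ∑ b, z b ^ (-1 : ℤ) * X b *
      (particle q ν u (-1) ^ m * particle q ν u 0 ^ (N - m)) (vacuum _)
        (Finset.univ.erase b) = 0 := by
    intro m hm
    let x : Fin (N + 1) → ℤ := Fin.cons (-1) fun j : Fin N => if (j : ℕ) < m then -1 else 0
    have hx : ∀ i, x i = if (i : ℕ) < m + 1 then -1 else 0 := by
      intro i
      refine Fin.cases ?_ (fun j => ?_) i
      · simp [x]
      · simp [x]
    have hmono : Monotone x := by
      intro i j hij
      have : (i : ℕ) ≤ j := hij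
      rw [hx, hx]
      split_ifs <;> omega
    have hdom : ∀ i j, x i ≤ x j + L := by
      intro i j
      rw [hx, hx]
      split_ifs <;> omega
    have h := hper x hmono hdom
    have hw : (List.ofFn fun i : Fin N => particle q ν u (x i.succ)).prod =
        particle q ν u (-1) ^ m * particle q ν u 0 ^ (N - m) := by
      rw [← prod_ofFn_ite _ _ hm]
      congr 2
      ext1 j
      simp only [x, Fin.cons_succ]
      split_ifs <;> rfl
    rw [betheFn_ringShift, betheFn_eq_fullComponent, List.ofFn_succ, List.prod_cons, hw] at h
    have h := mul_left_cancel₀ (inv_ne_zero hpref) h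
    rw [fullComponent_particle_mul, fullComponent_mul_particle _ _ _ _ _ fun f =>
      ((hcomm _ f).pow_left m).mul_left ((hcomm _ f).pow_left (N - m)), ← sub_eq_zero,
      ← Finset.sum_sub_distrib] at h
    rw [← h]
    refine Finset.sum_congr rfl fun b _ => ?_
    have h0 : x 0 = -1 := rfl
    rw [h0, zpow_add₀ (hz b), zpow_natCast]
    simp only [X, z]
    ring
  let C : Fin (N + 1) → ℂ := fun b => (particle q ν u 0 ^ N) (vacuum _) (Finset.univ.erase b)
  have hC : ∀ b, C b ≠ 0 := by
    intro b
    simp only [C, particle, zpow_zero]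
    rw [addLeft_one_pow_vacuum hq1 hinj N _ (by simp)]
    exact mul_ne_zero (div_ne_zero (qPoch_self_ne_zero hq N)
      (pow_ne_zero _ (sub_ne_zero.2 hq1.symm))) (vandermondeOn_ne_zero hinj _)
  -- The relations `hword` do not involve `μ`, so they may be summed with the weights `φ(m|N)` for
  -- any admissible `μ`; the binomial theorem then produces the dressing factors.
  have hμ : ∀ μ : ℂ, (μ = 0 → ν = 0) → ∑ b, z b ^ (-1 : ℤ) * X b *
      ((∏ a ∈ Finset.univ.erase b, (1 - μ * u a) / (1 - ν * u a)) * C b) = 0 := by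
    intro μ hμ
    have hd : ∀ k : ℕ, diagOp (fun a => (1 - μ * u a) / (1 - ν * u a)) * particle q ν u 0 ^ k =
        dressedParticle q μ ν u 0 ^ k * diagOp (fun a => (1 - μ * u a) / (1 - ν * u a)) :=
      fun k => SemiconjBy.pow_right (diagOp_mul_particle q μ ν u 0) k
    simp only [C, ← apply_vacuum_of_diagOp_mul (hd N)]
    rw [← sum_phi_particle hq hν hμ hu1 hνu 0 N]
    simp only [LinearMap.sum_apply, Finset.sum_apply, LinearMap.smul_apply, Pi.smul_apply,
      smul_eq_mul, Finset.mul_sum]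
    rw [Finset.sum_comm]
    refine Finset.sum_eq_zero fun m hm => ?_
    rw [← mul_zero (phi q μ ν m N), ← hword m (by simpa [Nat.lt_succ_iff] using hm),
      Finset.mul_sum]
    refine Finset.sum_congr rfl fun b _ => ?_
    rw [zero_sub]
    ring
  have hX1 : ∀ b, u b ≠ 0 → X b = 0 := by
    intro b hb
    -- For `μ = 1 / u b` the product of each label `c ≠ b` contains the vanishing factor of `b`.
    have h := hμ (u b)⁻¹ (fun h => absurd h (inv_ne_zero hb))
    rw [Finset.sum_eq_single b] at h
    · have hprod : ∏ a ∈ Finset.univ.erase b, (1 - (u b)⁻¹ * u a) / (1 - ν * u a) ≠ 0 := by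
        refine Finset.prod_ne_zero_iff.2 fun a ha => div_ne_zero (sub_ne_zero.2 fun e => ?_)
          (sub_ne_zero.2 (hνu a).symm)
        rw [eq_comm, inv_mul_eq_one₀ hb] at e
        exact Finset.ne_of_mem_erase ha (hinj e).symm
      exact (mul_eq_zero.1 ((mul_eq_zero.1 h).resolve_right (mul_ne_zero hprod (hC b)))).resolve_left
          (zpow_ne_zero _ (hz b))
    · intro c _ hc
      rw [Finset.prod_eq_zero (Finset.mem_erase.2 ⟨hc.symm, Finset.mem_univ b⟩)]
      · simp
      · simp [inv_mul_cancel₀ hb]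
    · simp
  have hX : ∀ b, X b = 0 := by
    intro b
    by_cases hb : u b = 0
    · have h := hμ 1 (fun h => absurd h one_ne_zero)
      rw [Finset.sum_eq_single b] at h
      · have hprod : ∏ a ∈ Finset.univ.erase b, (1 - 1 * u a) / (1 - ν * u a) ≠ 0 :=
          Finset.prod_ne_zero_iff.2 fun a _ => div_ne_zero
            (by rw [one_mul]; exact sub_ne_zero.2 (hu1 a).symm) (sub_ne_zero.2 (hνu a).symm)
        exact (mul_eq_zero.1 ((mul_eq_zero.1 h).resolve_right (mul_ne_zero hprod (hC b)))).resolve_left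
          (zpow_ne_zero _ (hz b))
      · intro c _ hc
        rw [hX1 c fun e => hc (hinj (e.trans hb.symm))]
        simp
      · simp
    · exact hX1 b hb
  intro b
  exact (sub_eq_zero.1 (hX b)).symm

end Necessity

/-! ### The transition matrix as a finite sum over jumps -/

section Kernel

variable {Site : Type}

/-- The configuration after `p i` particles have jumped from every site `i` to `τ i`. -/
noncomputable def transport (τ : Site ≃ Site) (n p : Site →₀ ℕ) : Site →₀ ℕ :=
  n - p + p.equivMapDomain τ

lemma transport_apply (τ : Site ≃ Site) (n p : Site →₀ ℕ) (i : Site) :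
    transport τ n p i = n i - p i + p (τ.symm i) := rfl

/-- The weight of the jump of `p i` of the `n i` particles, for all sites `i`. -/
noncomputable def jumpWeight (q μ ν : ℂ) (p n : Site →₀ ℕ) : ℂ := ∏ᶠ i, phi q μ ν (p i) (n i)

lemma mem_Icc_zero [DecidableEq Site] {p n : Site →₀ ℕ} : p ∈ Finset.Icc 0 n ↔ ∀ i, p i ≤ n i := by
  rw [Finset.mem_Icc]
  exact ⟨fun h i => h.2 i, fun h => ⟨zero_le, h⟩⟩

lemma transition_eq_sum [AddCommGroupWithOne Site] [DecidableEq Site] (q μ ν : ℂ)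
    (n n' : Site →₀ ℕ) :
    transition q μ ν n n' = ∑ p ∈ Finset.Icc 0 n',
      if n = transport (Equiv.addRight 1) n' p then jumpWeight q μ ν p n' else 0 := by
  -- Finiteness is needed because `finprod` defaults to `1` on infinite support, even if a factor is
  -- `0`.
  have hfin : ∀ p : Site →₀ ℕ, (Function.mulSupport (siteFactor q μ ν n n' p)).Finite := by
    intro p
    refine (n.support ∪ n'.support ∪ p.support ∪
      p.support.image (Equiv.addRight (1 : Site))).finite_toSet.subset fun i hi => ?_
    by_contra hni
    simp only [Finset.coe_union, Set.mem_union, Finset.mem_coe, Finsupp.mem_support_iff, not_or,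
      not_not, Finset.mem_image, not_exists, not_and] at hni
    obtain ⟨⟨⟨h1, h2⟩, h3⟩, h4⟩ := hni
    have h5 : p (i - 1) = 0 := by
      by_contra h
      exact h4 (i - 1) h (by simp)
    apply hi
    simp [siteFactor, h1, h2, h3, h5, phi_zero_zero]
  have hterm : ∀ p ∈ Finset.Icc 0 n', ∏ᶠ i, siteFactor q μ ν n n' p i =
      if n = transport (Equiv.addRight 1) n' p then jumpWeight q μ ν p n' else 0 := by
    intro p hp
    rw [mem_Icc_zero] at hp
    have hiff : ∀ i, (n i : ℤ) - n' i = (p (i - 1) : ℤ) - p i ↔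
        n i = transport (Equiv.addRight 1) n' p i := by
      intro i
      have := hp i
      have h : (Equiv.addRight (1 : Site)).symm i = i - 1 := by simp [sub_eq_add_neg]
      rw [transport_apply, h]
      omega
    split_ifs with h
    · refine finprod_congr fun i => ?_
      rw [siteFactor, if_pos ((hiff i).2 (DFunLike.congr_fun h i))]
    · obtain ⟨i, hi⟩ : ∃ i, n i ≠ transport (Equiv.addRight 1) n' p i := by
        by_contra! hc
        exact h (Finsupp.ext hc)
      exact finprod_eq_zero _ i (if_neg fun e => hi ((hiff i).1 e)) (hfin p)
  rw [transition, finsum_eq_sum_of_support_subset (s := Finset.Icc 0 n')]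
  · exact Finset.sum_congr rfl hterm
  · intro p hp
    rw [Finset.mem_coe, mem_Icc_zero]
    by_contra! hc
    obtain ⟨i, hi⟩ := hc
    refine hp (finprod_eq_zero _ i ?_ (hfin p))
    simp [siteFactor, phi, not_le.2 hi]

lemma hasFiniteMulSupport_comp {f : ℕ → ℂ} (hf : f 0 = 1) (n : Site →₀ ℕ) :
    (Function.mulSupport fun i => f (n i)).Finite :=
  n.support.finite_toSet.subset fun i hi => by
    rw [Finset.mem_coe, Finsupp.mem_support_iff]
    intro h
    exact hi (by simp [h, hf])

lemma stationaryWeight_ne_zero {q ν : ℂ} (hq : ∀ k : ℕ, 1 ≤ k → q ^ k ≠ 1)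
    (hν : ∀ k : ℕ, ν * q ^ k ≠ 1) [AddCommGroupWithOne Site] (n : Site →₀ ℕ) :
    stationaryWeight q ν n ≠ 0 := by
  rw [stationaryWeight, finprod_eq_prod _ (hasFiniteMulSupport_comp (siteWeight_zero q ν) n)]
  exact Finset.prod_ne_zero_iff.2 fun i _ => siteWeight_ne_zero hq hν _

/-- The jump weights relative to the product measure. -/
lemma jumpWeight_mul_stationaryWeight {q μ ν : ℂ} (hq : ∀ k : ℕ, 1 ≤ k → q ^ k ≠ 1)
    (hν : ∀ k : ℕ, ν * q ^ k ≠ 1) (hμ : μ = 0 → ν = 0) [AddCommGroupWithOne Site]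
    {p n : Site →₀ ℕ} (hp : ∀ i, p i ≤ n i) :
    jumpWeight q μ ν p n * stationaryWeight q ν n =
      (∏ᶠ i, homPoch q μ ν (p i) / qPoch q q (p i)) *
        ∏ᶠ i, qPoch μ q ((n - p) i) / qPoch q q ((n - p) i) := by
  have h1 : (Function.mulSupport fun i => phi q μ ν (p i) (n i)).Finite :=
    n.support.finite_toSet.subset fun i hi => by
      rw [Finset.mem_coe, Finsupp.mem_support_iff]
      intro h
      have := hp i
      exact hi (by simp [h, Nat.le_zero.1 (h ▸ this), phi_zero_zero])
  rw [jumpWeight, stationaryWeight,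
    ← finprod_mul_distrib h1 (hasFiniteMulSupport_comp (siteWeight_zero q ν) n),
    ← finprod_mul_distrib
      (hasFiniteMulSupport_comp (f := fun k => homPoch q μ ν k / qPoch q q k)
        (by simp [homPoch_zero, qPoch_zero]) p)
      (hasFiniteMulSupport_comp (f := fun k => qPoch μ q k / qPoch q q k)
        (by simp [qPoch_zero]) (n - p))]
  exact finprod_congr fun i => phi_mul_siteWeight hq hν hμ (hp i)

/-- Jumps to the right are undone by sending the same particles back: the jump vector is shifted by
one site and the staying particles are unchanged. Weight times measure depends only on the multiset
of jump numbers and on the staying particles, so it agrees for both directions. -/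
lemma transition_mul_stationaryWeight {q μ ν : ℂ} (hq : ∀ k : ℕ, 1 ≤ k → q ^ k ≠ 1)
    (hν : ∀ k : ℕ, ν * q ^ k ≠ 1) (hμ : μ = 0 → ν = 0) [AddCommGroupWithOne Site]
    [DecidableEq Site] (n n' : Site →₀ ℕ) :
    transition q μ ν n n' * stationaryWeight q ν n' = stationaryWeight q ν n *
      ∑ p ∈ Finset.Icc 0 n,
        if n' = transport (Equiv.addRight 1).symm n p then jumpWeight q μ ν p n else 0 := by
  rw [transition_eq_sum, Finset.sum_mul, Finset.mul_sum]
  simp only [ite_mul, mul_ite, zero_mul, mul_zero]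
  rw [← Finset.sum_filter, ← Finset.sum_filter]
  have key : ∀ (τ : Site ≃ Site) (n n' p : Site →₀ ℕ),
      p ∈ (Finset.Icc 0 n').filter (fun p => n = transport τ n' p) →
      n - p.equivMapDomain τ = n' - p ∧ p.equivMapDomain τ ∈ (Finset.Icc 0 n).filter
        (fun p => n' = transport τ.symm n p) := by
    intro τ n n' p hp
    rw [Finset.mem_filter, mem_Icc_zero] at hp
    obtain ⟨hp, rfl⟩ := hp
    have h1 : transport τ n' p - p.equivMapDomain τ = n' - p := by
      ext i
      simp [transport]
    refine ⟨h1, Finset.mem_filter.2 ⟨mem_Icc_zero.2 fun i => ?_, ?_⟩⟩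
    · simp [transport]
    · rw [transport, h1]
      ext i
      have := hp i
      simp [Finsupp.equivMapDomain_apply]
      omega
  refine Finset.sum_bij' (fun p _ => p.equivMapDomain (Equiv.addRight 1))
    (fun p _ => p.equivMapDomain (Equiv.addRight 1).symm)
    (fun p hp => (key _ _ _ p hp).2) (fun p hp => (key _ _ _ p hp).2) ?_ ?_ ?_
  · intro p _
    ext i
    simp [Finsupp.equivMapDomain_apply]
  · intro p _
    ext i
    simp [Finsupp.equivMapDomain_apply]
  · intro p hp
    have h1 := key _ _ _ p hp
    rw [jumpWeight_mul_stationaryWeight hq hν hμ (mem_Icc_zero.1 (Finset.mem_filter.1 hp).1),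
      mul_comm (stationaryWeight q ν n), jumpWeight_mul_stationaryWeight hq hν hμ
        (mem_Icc_zero.1 (Finset.mem_filter.1 h1.2).1), h1.1]
    congr 1
    exact (finprod_comp (g := fun i => homPoch q μ ν (p i) / qPoch q q (p i))
      (Equiv.addRight (1 : Site)).symm (Equiv.bijective _)).symm

/-- Each jump vector reaches exactly one configuration, as `occ` is injective; the possibly infinite
sum is a finite sum of one-term sums. -/
lemma hasSum_kernel [DecidableEq Site] {q μ ν : ℂ} {X : Type} {occ : X → Site →₀ ℕ}
    (hocc : Function.Injective occ) (ψ : X → ℂ) (τ : Site ≃ Site) (n : Site →₀ ℕ)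
    (y : (Site →₀ ℕ) → X) (hy : ∀ p ∈ Finset.Icc 0 n, occ (y p) = transport τ n p) :
    HasSum (fun x => (∑ p ∈ Finset.Icc 0 n,
        if occ x = transport τ n p then jumpWeight q μ ν p n else 0) * ψ x)
      (∑ p ∈ Finset.Icc 0 n, jumpWeight q μ ν p n * ψ (y p)) := by
  simp only [Finset.sum_mul]
  refine hasSum_sum fun p hp => ?_
  have := hasSum_single (f := fun x => (if occ x = transport τ n p then jumpWeight q μ ν p n
    else 0) * ψ x) (y p) fun x hx => ?_
  · simpa [hy p hp] using this
  · rw [if_neg, zero_mul]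
    rw [← hy p hp]
    exact fun h => hx (hocc h)

/-- Sites outside the range of `e` are empty and contribute `φ(0|0) = 1`. -/
lemma sum_jumpWeight_mul [DecidableEq Site] (q μ ν : ℂ) (n : Site →₀ ℕ) {K : ℕ} (e : Fin K → Site)
    (he : Function.Injective e) (hn : ∀ i, n i ≠ 0 → ∃ k, e k = i) (G : (Fin K → ℕ) → ℂ) :
    ∑ p ∈ Finset.Icc 0 n, jumpWeight q μ ν p n * G (fun k => p (e k)) =
      ∑ g ∈ Fintype.piFinset fun k => Finset.range (n (e k) + 1),
        (∏ k, phi q μ ν (g k) (n (e k))) * G g := by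
  refine Finset.sum_bij (fun p _ k => p (e k)) ?_ ?_ ?_ ?_
  · intro p hp
    rw [Fintype.mem_piFinset]
    intro k
    exact Finset.mem_range.2 (Nat.lt_succ_of_le (mem_Icc_zero.1 hp _))
  · intro p hp p' hp' h
    ext i
    by_cases hi : n i = 0
    · have h1 := mem_Icc_zero.1 hp i
      have h2 := mem_Icc_zero.1 hp' i
      omega
    · obtain ⟨k, rfl⟩ := hn i hi
      exact congrFun h k
  · intro g hg
    rw [Fintype.mem_piFinset] at hg
    refine ⟨Finsupp.embDomain ⟨e, he⟩ (Finsupp.equivFunOnFinite.symm g), ?_, ?_⟩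
    · rw [mem_Icc_zero]
      intro i
      by_cases hi : ∃ k, e k = i
      · obtain ⟨k, rfl⟩ := hi
        have h1 := Finsupp.embDomain_apply_self ⟨e, he⟩ (Finsupp.equivFunOnFinite.symm g) k
        have h2 := Finset.mem_range.1 (hg k)
        change Finsupp.embDomain ⟨e, he⟩ _ (e k) = _ at h1
        rw [h1]
        exact Nat.le_of_lt_succ h2
      · rw [Finsupp.embDomain_of_notMem_range _ _ _ (by simpa using hi)]
        exact Nat.zero_le _
    · funext k
      exact Finsupp.embDomain_apply_self ⟨e, he⟩ (Finsupp.equivFunOnFinite.symm g) k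
  · intro p hp
    congr 1
    rw [jumpWeight, finprod_eq_prod_of_mulSupport_subset (s := Finset.univ.image e),
      Finset.prod_image he.injOn]
    intro i hi
    by_contra hni
    have hni : n i = 0 := by
      by_contra h
      obtain ⟨k, rfl⟩ := hn i h
      simp at hni
    have := mem_Icc_zero.1 hp i
    exact hi (by simp [hni, Nat.le_zero.1 (hni ▸ this), phi_zero_zero])

lemma ofFn_coe_eq_map_range {α : Type*} (f : ℕ → α) (K : ℕ) :
    (List.ofFn fun k : Fin K => f k) = (List.range K).map f := by
  rw [List.ofFn_eq_map, ← List.map_coe_finRange_eq_range, List.map_map]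
  rfl

/-- The sum over all jumps factorizes over the sites. -/
lemma sum_jumpWeight_mul_prod [DecidableEq Site] {E : Type*} [Ring E] [Algebra ℂ E] (β : E →ₗ[ℂ] ℂ)
    (q μ ν : ℂ) (n : Site →₀ ℕ) {K : ℕ} (e : ℕ → Site)
    (he : Function.Injective fun k : Fin K => e k) (hn : ∀ i, n i ≠ 0 → ∃ k < K, e k = i)
    (A B : ℕ → E) :
    ∑ p ∈ Finset.Icc 0 n, jumpWeight q μ ν p n * β ((List.range K).map fun k =>
        A k ^ p (e k) * B k ^ (n (e k) - p (e k))).prod =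
      β ((List.range K).map fun k => ∑ m ∈ Finset.range (n (e k) + 1),
        phi q μ ν m (n (e k)) • (A k ^ m * B k ^ (n (e k) - m))).prod := by
  simp only [← ofFn_coe_eq_map_range]
  rw [sum_jumpWeight_mul q μ ν n (fun k : Fin K => e k) he
    (fun i hi => by obtain ⟨k, hk, h⟩ := hn i hi; exact ⟨⟨k, hk⟩, h⟩)
    (fun g => β (List.ofFn fun k : Fin K =>
      A k ^ g k * B k ^ (n (e k) - g k)).prod),
    ← sum_piFinset_prod_ofFn (fun k : Fin K => Finset.range (n (e k) + 1))
      (fun k m => phi q μ ν m (n (e k)) • (A k ^ m * B k ^ (n (e k) - m))), map_sum]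
  refine Finset.sum_congr rfl fun g _ => ?_
  rw [← smul_eq_mul, ← map_smul]
  congr 1
  have : ∀ (M : ℕ) (c : Fin M → ℂ) (w : Fin M → E),
      (∏ k, c k) • (List.ofFn w).prod = (List.ofFn fun k => c k • w k).prod := by
    intro M
    induction M with
    | zero => simp
    | succ M ih =>
      intro c w
      rw [List.ofFn_succ, List.ofFn_succ, List.prod_cons, List.prod_cons, ← ih,
        Fin.prod_univ_succ, smul_mul_smul_comm]
  exact this _ _ _

lemma sum_jumpWeight [DecidableEq Site] {q μ ν : ℂ} (hq : ∀ k : ℕ, 1 ≤ k → q ^ k ≠ 1)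
    (hν : ∀ k : ℕ, ν * q ^ k ≠ 1) (hμ : μ = 0 → ν = 0) (n : Site →₀ ℕ) :
    ∑ p ∈ Finset.Icc 0 n, jumpWeight q μ ν p n = 1 := by
  let e := n.support.equivFin.symm
  have h := sum_jumpWeight_mul q μ ν n (fun k => (e k : Site))
    (Subtype.val_injective.comp e.injective)
    (fun i hi => ⟨e.symm ⟨i, Finsupp.mem_support_iff.2 hi⟩, by simp⟩) (fun _ => 1)
  simp only [mul_one] at h
  rw [h, ← Finset.prod_univ_sum (f := fun k m => phi q μ ν m (n (e k)))]
  exact Finset.prod_eq_one fun k _ => sum_phi hq hν hμ _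

end Kernel

/-! ### Ordered coordinates and occupation numbers -/

section Sector

variable {Site : Type}

lemma occupation_apply [AddCommGroupWithOne Site] [DecidableEq Site] {N : ℕ} (s : Fin N → Site)
    (t : Site) : occupation s t = (Finset.univ.filter fun j => s j = t).card := by
  rw [occupation, Finsupp.finsetSum_apply, Finset.card_filter]
  exact Finset.sum_congr rfl fun j _ => by rw [Finsupp.single_apply]

lemma exists_of_occupation_ne_zero [AddCommGroupWithOne Site] [DecidableEq Site] {N : ℕ}
    {s : Fin N → Site} {t : Site} (h : occupation s t ≠ 0) : ∃ j, s j = t := by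
  rw [occupation_apply, Finset.card_ne_zero] at h
  obtain ⟨j, hj⟩ := h
  exact ⟨j, (Finset.mem_filter.1 hj).2⟩

lemma toMultiset_occupation [AddCommGroupWithOne Site] {N : ℕ} (s : Fin N → Site) :
    Finsupp.toMultiset (occupation s) = Multiset.ofList (List.ofFn s) := by
  rw [occupation, map_sum, ← Fin.univ_val_map]
  simp only [Finsupp.toMultiset_single, one_nsmul]
  exact Multiset.sum_map_singleton (Finset.univ.val.map s) ▸ by rw [Multiset.map_map]; rfl

/-- Occupation numbers determine the multiset of coordinates, and a sorted list is determined by its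
multiset. -/
lemma occupation_comp_injective [AddCommGroupWithOne Site] {α : Type} [LinearOrder α]
    (f : α ≃ Site) {N : ℕ} :
    Function.Injective fun x : Fin N →o α => occupation fun j => f (x j) := by
  intro x y h
  have h1 := congrArg Finsupp.toMultiset h
  simp only [toMultiset_occupation] at h1
  have h2 := (Multiset.coe_eq_coe.1 h1).map f.symm
  rw [List.map_ofFn, List.map_ofFn] at h2
  have h3 : ∀ z : Fin N →o α, f.symm ∘ (fun j => f (z j)) = z := fun z => by
    ext j
    simp
  rw [h3, h3] at h2
  have h4 := List.Perm.eq_of_pairwise (fun b c _ _ h1 h2 => le_antisymm h1 h2)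
    x.monotone.sortedLE_ofFn.pairwise y.monotone.sortedLE_ofFn.pairwise h2
  exact DFunLike.coe_injective (List.ofFn_injective h4)

lemma exists_occupation_eq [AddCommGroupWithOne Site] {α : Type} [LinearOrder α]
    (f : α ≃ Site) {N : ℕ} {n : Site →₀ ℕ} (hn : n.degree = N) :
    ∃ x : Fin N →o α, (occupation fun j => f (x j)) = n := by
  let l := ((Finsupp.toMultiset n).map f.symm).sort (· ≤ ·)
  have hl : l.length = N := by
    rw [Multiset.length_sort, Multiset.card_map, Finsupp.card_toMultiset, ← hn, Finsupp.degree]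
    rfl
  have hmono : Monotone fun j : Fin N => l.get (j.cast hl.symm) := by
    intro i j hij
    exact (Multiset.pairwise_sort _ _).sortedLE.monotone_get hij
  have h1 : List.ofFn (fun j : Fin N => f (l.get (j.cast hl.symm))) = l.map f := by
    subst hl
    rw [← Function.comp_def f, ← List.map_ofFn]
    exact congrArg _ (List.ofFn_get l)
  have h2 : Finsupp.toMultiset (occupation fun j => f (l.get (j.cast hl.symm))) =
      Finsupp.toMultiset n := by
    rw [toMultiset_occupation, h1, ← Multiset.map_coe, Multiset.sort_eq, Multiset.map_map]
    simp
  refine ⟨⟨_, hmono⟩, ?_⟩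
  classical
  ext i
  rw [← Finsupp.count_toMultiset n, ← h2, Finsupp.count_toMultiset]
  rfl

lemma degree_occupation [AddCommGroupWithOne Site] {N : ℕ} (s : Fin N → Site) :
    (occupation s).degree = N := by
  simp [occupation]

lemma degree_transport [DecidableEq Site] (τ : Site ≃ Site) {n p : Site →₀ ℕ}
    (hp : p ∈ Finset.Icc 0 n) : (transport τ n p).degree = n.degree := by
  have h1 : n - p + p = n := tsub_add_cancel_of_le (Finset.mem_Icc.1 hp).2
  have h2 : (p.equivMapDomain τ).degree = p.degree := by
    rw [Finsupp.equivMapDomain_eq_mapDomain]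
    simp
  rw [transport, map_add, h2, ← map_add, h1]

lemma exists_occupation_eq_transport [AddCommGroupWithOne Site] [DecidableEq Site] {α : Type}
    [LinearOrder α] (f : α ≃ Site) {N : ℕ} (τ : Site ≃ Site) (x : Fin N →o α) {p : Site →₀ ℕ}
    (hp : p ∈ Finset.Icc 0 (occupation fun j => f (x j))) :
    ∃ y : Fin N →o α,
      (occupation fun j => f (y j)) = transport τ (occupation fun j => f (x j)) p :=
  exists_occupation_eq f (by rw [degree_transport τ hp, degree_occupation])

end Sector

/-! ### Eigenvector equations as jump sums -/

section Eigen

variable {Site : Type} [AddCommGroupWithOne Site] [DecidableEq Site]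

/-- A row of `M⁰` is the law of jumps to the left from `x`, which involves finitely many targets
even on `ℤ`. -/
lemma rightEigenEq_of_sum {q μ ν : ℂ} (hq : ∀ k : ℕ, 1 ≤ k → q ^ k ≠ 1)
    (hν : ∀ k : ℕ, ν * q ^ k ≠ 1) (hμ : μ = 0 → ν = 0) {X : Type} {occ : X → Site →₀ ℕ}
    (hocc : Function.Injective occ)
    (hsec : ∀ x, ∀ p ∈ Finset.Icc 0 (occ x),
      ∃ y, occ y = transport (Equiv.addRight 1).symm (occ x) p)
    (lam : ℂ) (ψ : X → ℂ)
    (h : ∀ x, ∀ y : (Site →₀ ℕ) → X,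
      (∀ p ∈ Finset.Icc 0 (occ x), occ (y p) = transport (Equiv.addRight 1).symm (occ x) p) →
      ∑ p ∈ Finset.Icc 0 (occ x), jumpWeight q μ ν p (occ x) * ψ (y p) = lam * ψ x) :
    RightEigenEq (conjMarkovMatrix q μ ν occ) lam ψ ∧
      RightEigenEq (markovMatrix q μ ν occ) lam fun x => stationaryMeasure q ν occ x * ψ x := by
  have key : ∀ x, HasSum (fun y => (∑ p ∈ Finset.Icc 0 (occ x),
      if occ y = transport (Equiv.addRight 1).symm (occ x) p
      then jumpWeight q μ ν p (occ x) else 0) * ψ y) (lam * ψ x) := by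
    intro x
    have : Nonempty X := ⟨x⟩
    choose! y hy using hsec x
    rw [← h x y hy]
    exact hasSum_kernel hocc ψ _ _ y hy
  have hM : ∀ x y, markovMatrix q μ ν occ x y * stationaryMeasure q ν occ y =
      stationaryMeasure q ν occ x * ∑ p ∈ Finset.Icc 0 (occ x),
        if occ y = transport (Equiv.addRight 1).symm (occ x) p
        then jumpWeight q μ ν p (occ x) else 0 :=
    fun x y => transition_mul_stationaryWeight hq hν hμ (occ x) (occ y)
  constructor
  · intro x
    have hP : stationaryMeasure q ν occ x ≠ 0 := stationaryWeight_ne_zero hq hν _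
    refine (congrArg (fun g => HasSum g _) (funext fun y => ?_)).mpr (key x)
    change 1 / stationaryMeasure q ν occ x * markovMatrix q μ ν occ x y *
      (1 / stationaryMeasure q ν occ y)⁻¹ * ψ y = _
    rw [one_div, one_div, inv_inv, mul_assoc _ (markovMatrix q μ ν occ x y), hM,
      inv_mul_cancel_left₀ hP]
  · intro x
    have h1 := (key x).mul_left (stationaryMeasure q ν occ x)
    rw [mul_left_comm] at h1
    refine (congrArg (fun g => HasSum g _) (funext fun y => ?_)).mpr h1
    rw [← mul_assoc, hM, mul_assoc]

lemma leftEigenEq_of_sum {q μ ν : ℂ} {X : Type} {occ : X → Site →₀ ℕ}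
    (hocc : Function.Injective occ)
    (hsec : ∀ x, ∀ p ∈ Finset.Icc 0 (occ x), ∃ y, occ y = transport (Equiv.addRight 1) (occ x) p)
    (lam : ℂ) (ψ : X → ℂ)
    (h : ∀ x, ∀ y : (Site →₀ ℕ) → X,
      (∀ p ∈ Finset.Icc 0 (occ x), occ (y p) = transport (Equiv.addRight 1) (occ x) p) →
      ∑ p ∈ Finset.Icc 0 (occ x), jumpWeight q μ ν p (occ x) * ψ (y p) = lam * ψ x) :
    LeftEigenEq (markovMatrix q μ ν occ) lam ψ := by
  intro x
  have : Nonempty X := ⟨x⟩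
  choose! y hy using hsec x
  rw [← h x y hy]
  convert! hasSum_kernel (q := q) (μ := μ) (ν := ν) hocc ψ _ _ y hy using 2 with z
  rw [markovMatrix, transition_eq_sum, mul_comm]

lemma stationary_of_sector {q μ ν : ℂ} (hq : ∀ k : ℕ, 1 ≤ k → q ^ k ≠ 1)
    (hν : ∀ k : ℕ, ν * q ^ k ≠ 1) (hμ : μ = 0 → ν = 0) {X : Type} {occ : X → Site →₀ ℕ}
    (hocc : Function.Injective occ)
    (hsec : ∀ x, ∀ p ∈ Finset.Icc 0 (occ x),
      ∃ y, occ y = transport (Equiv.addRight 1).symm (occ x) p) :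
    RightEigenEq (markovMatrix q μ ν occ) 1 (stationaryMeasure q ν occ) := by
  have := (rightEigenEq_of_sum hq hν hμ hocc hsec 1 (fun _ => 1) fun x y _ => by
    simpa using sum_jumpWeight hq hν hμ (occ x)).2
  simpa using this

end Eigen

/-! ### The jump sum of the Bethe function on a window of sites -/

section BetheSum

variable {Site : Type} [DecidableEq Site]

/-- The jump sum of the Bethe function, for sites `e i` indexed by the coordinates `i`. -/
lemma sum_jumpWeight_mul_betheFn {q μ ν : ℂ} (hq : ∀ k : ℕ, 1 ≤ k → q ^ k ≠ 1)
    (hν : ∀ k : ℕ, ν * q ^ k ≠ 1) (hμ : μ = 0 → ν = 0) {N : ℕ} {u : Fin N → ℂ}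
    (hu1 : ∀ i, u i ≠ 1) (hνu : ∀ i, ν * u i ≠ 1)
    {X : Type} {occ : X → Site →₀ ℕ} {coord : X → Fin N → ℤ} (hmono : ∀ x, Monotone (coord x))
    {τ : Site ≃ Site} {e : ℤ → Site} (he : ∀ i, τ.symm (e i) = e (i + 1)) (a : ℤ) (K : ℕ)
    (hinj : Function.Injective fun k : Fin (K + 1) => e (a + ((k : ℕ) : ℤ)))
    (hcount : ∀ y, ∀ k < K + 1, occ y (e (a + (k : ℕ))) =
      (Finset.univ.filter fun j => coord y j = a + (k : ℕ)).card)
    {x : X} (hxlo : ∀ j, a ≤ coord x j) (hxhi : ∀ j, coord x j < a + (K + 1 : ℕ))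
    (hrange : ∀ s, occ x s ≠ 0 → ∃ k < K + 1, e (a + (k : ℕ)) = s)
    {y : (Site →₀ ℕ) → X} (hy : ∀ p ∈ Finset.Icc 0 (occ x), occ (y p) = transport τ (occ x) p)
    (hylo : ∀ p ∈ Finset.Icc 0 (occ x), ∀ j, a ≤ coord (y p) j)
    (hyhi : ∀ p ∈ Finset.Icc 0 (occ x), ∀ j, coord (y p) j < a + (K + 1 : ℕ))
    (hedge : (e (a + (K + 1 : ℕ)) = e a ∧ (∀ i j, i ≠ j → u i ≠ q * u j) ∧
        BetheEquations q ν (K + 1) u) ∨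
      (occ x (e a) = 0 ∧ occ x (e (a + (K + 1 : ℕ))) = 0)) :
    ∑ p ∈ Finset.Icc 0 (occ x), jumpWeight q μ ν p (occ x) * betheFn q ν u (coord (y p)) =
      betheEigenvalue μ ν u * betheFn q ν u (coord x) := by
  let D := particle q ν u
  let lam : Fin N → ℂ := fun a => (1 - μ * u a) / (1 - ν * u a)
  let κ := (∏ i, ∏ j ∈ Finset.Ioi i, (u i - q * u j))⁻¹
  have hword : ∀ z, (∀ j, a ≤ coord z j) → (∀ j, coord z j < a + (K + 1 : ℕ)) →
      betheFn q ν u (coord z) = κ * fullComponent ((List.range (K + 1)).map fun k : ℕ =>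
        D (a + k) ^ occ z (e (a + k))).prod := by
    intro z hlo hhi
    rw [betheFn_eq_fullComponent, prod_ofFn_eq_prod_range (particle q ν u) (hmono z) hlo hhi]
    congr 3
    refine List.map_congr_left fun k hk => ?_
    rw [hcount z k (List.mem_range.1 hk)]
  -- The word after the jump, grouped by the site of origin: from `a + k`, `p` particles now sit at
  -- `a + k - 1`.
  have hterm : ∀ p ∈ Finset.Icc 0 (occ x), betheFn q ν u (coord (y p)) =
      κ * fullComponent ((List.range (K + 1)).map fun k : ℕ =>
        D (a + k - 1) ^ p (e (a + k)) * D (a + k) ^ (occ x (e (a + k)) - p (e (a + k)))).prod := by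
    intro p hp
    rw [hword _ (hylo p hp) (hyhi p hp), hy p hp]
    congr 1
    have hexp : ∀ k : ℕ, transport τ (occ x) p (e (a + k)) =
        occ x (e (a + k)) - p (e (a + k)) + p (e (a + (k + 1 : ℕ))) := by
      intro k
      rw [transport_apply, he]
      push_cast
      rw [add_assoc]
    simp only [hexp]
    rw [prod_range_shift D a (fun k => p (e (a + k)))
      (fun k => occ x (e (a + k)) - p (e (a + k))) K, List.range_succ]
    simp only [List.map_append, List.prod_append, List.map_cons, List.map_nil, List.prod_cons,
      List.prod_nil, mul_one, pow_add]
    -- On the ring, the letters at `a - 1` in front stand for particles that re-enter at `a + K`,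
    -- and cyclicity moves them to the back. On the line no particle crosses the edges.
    rcases hedge with ⟨h1, hu, hB⟩ | ⟨h1, h2⟩
    · have hcomm : ∀ x f, Commute (D x) (addRight q u f) := fun x f =>
        commute_addLeft_addRight _ _ _ _
      rw [fullComponent_cyclic_pow hu1 hνu hu hB]
      · have : a - 1 + ((K + 1 : ℕ) : ℤ) = a + K := by push_cast; ring
        rw [this, h1, Nat.cast_zero, add_zero, mul_assoc]
      · intro f
        refine Commute.mul_left (Commute.list_prod_left _ _ ?_) ((hcomm _ f).pow_left _)
        intro w hw
        obtain ⟨k, -, rfl⟩ := List.mem_map.1 hw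
        exact ((hcomm _ f).pow_left _).mul_left ((hcomm _ f).pow_left _)
    · have h3 := mem_Icc_zero.1 hp (e a)
      have h4 := mem_Icc_zero.1 hp (e (a + (K + 1 : ℕ)))
      rw [h1] at h3
      rw [h2] at h4
      rw [Nat.cast_zero, add_zero, Nat.le_zero.1 h3, Nat.le_zero.1 h4, pow_zero, pow_zero,
        one_mul, mul_one]
  have hsum := sum_jumpWeight_mul_prod (fullComponent (N := N)) q μ ν (occ x)
    (K := K + 1) (fun k : ℕ => e (a + k)) hinj hrange (fun k : ℕ => D (a + k - 1))
    (fun k : ℕ => D (a + k))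
  have hdress : ∀ l : List ℕ, diagOp lam * (l.map fun k : ℕ => D (a + k) ^ occ x (e (a + k))).prod =
      (l.map fun k : ℕ => dressedParticle q μ ν u (a + k) ^ occ x (e (a + k))).prod *
        diagOp lam := by
    intro l
    induction l with
    | nil => simp
    | cons k l ih =>
      have h1 : diagOp lam * D (a + k) ^ occ x (e (a + k)) =
          dressedParticle q μ ν u (a + k) ^ occ x (e (a + k)) * diagOp lam :=
        SemiconjBy.pow_right (diagOp_mul_particle q μ ν u (a + k)) _
      rw [List.map_cons, List.map_cons, List.prod_cons, List.prod_cons, ← mul_assoc, h1,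
        mul_assoc, ih, mul_assoc]
  rw [Finset.sum_congr rfl fun p hp => by rw [hterm p hp, mul_left_comm], ← Finset.mul_sum, hsum,
    hword x hxlo hxhi, mul_left_comm]
  congr 1
  simp only [D, sum_phi_particle hq hν hμ hu1 hνu]
  rw [fullComponent_apply, apply_vacuum_of_diagOp_mul (hdress _)]
  rfl

end BetheSum

/-! ### The infinite lattice and the ring -/

section Lattices

lemma monotone_parity {N : ℕ} {x : Fin N → ℤ} (hx : Monotone x) : Monotone (parity x) :=
  fun _ _ hij => neg_le_neg (hx (Fin.rev_le_rev.2 hij))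

lemma card_filter_parity {N : ℕ} (x : Fin N → ℤ) (t : ℤ) :
    (Finset.univ.filter fun j => parity x j = t).card =
      (Finset.univ.filter fun j => x j = -t).card := by
  refine Finset.card_equiv Fin.revPerm fun j => ?_
  simp [parity, neg_eq_iff_eq_neg]

lemma parity_zero {N : ℕ} : parity (fun _ : Fin N => (0 : ℤ)) = fun _ => 0 := by
  funext i
  simp [parity]

lemma lineOcc_apply {N : ℕ} (x : LineConfig N) (t : ℤ) :
    lineOcc x t = (Finset.univ.filter fun j => x j = t).card := occupation_apply _ _

lemma lineOcc_injective {N : ℕ} : Function.Injective (lineOcc (N := N)) :=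
  occupation_comp_injective (Equiv.refl ℤ)

lemma exists_lineOcc_eq_transport {N : ℕ} (τ : ℤ ≃ ℤ) (x : LineConfig N) {p : ℤ →₀ ℕ}
    (hp : p ∈ Finset.Icc 0 (lineOcc x)) : ∃ y : LineConfig N, lineOcc y = transport τ (lineOcc x) p :=
  exists_occupation_eq_transport (Equiv.refl ℤ) τ x hp

lemma exists_bound {N : ℕ} (x : Fin N → ℤ) : ∃ B : ℕ, ∀ j, -(B : ℤ) < x j ∧ x j < B := by
  refine ⟨∑ j, (x j).natAbs + 1, fun j => ?_⟩
  have : (x j).natAbs ≤ ∑ j, (x j).natAbs :=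
    Finset.single_le_sum (f := fun j => (x j).natAbs) (fun _ _ => Nat.zero_le _)
      (Finset.mem_univ j)
  omega

/-- The coordinates of a configuration reached in one step. -/
lemma lineOcc_transport_bound {N : ℕ} {τ : ℤ ≃ ℤ} (hτ : ∀ i, |τ.symm i - i| ≤ 1)
    {x y : LineConfig N} {p : ℤ →₀ ℕ} (hp : p ∈ Finset.Icc 0 (lineOcc x))
    (hy : lineOcc y = transport τ (lineOcc x) p) {B : ℕ} (hB : ∀ j, -(B : ℤ) < x j ∧ x j < B)
    (j : Fin N) : -(B : ℤ) ≤ y j ∧ y j ≤ B := by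
  have h1 : lineOcc y (y j) ≠ 0 := by
    rw [lineOcc_apply, Finset.card_ne_zero]
    exact ⟨j, by simp⟩
  have hx : ∀ s, lineOcc x s ≠ 0 → -(B : ℤ) < s ∧ s < B := by
    intro s hs
    obtain ⟨k, rfl⟩ := exists_of_occupation_ne_zero hs
    exact hB k
  rw [hy, transport_apply] at h1
  have h2 := mem_Icc_zero.1 hp (τ.symm (y j))
  have h3 := abs_le.1 (hτ (y j))
  by_cases h : lineOcc x (y j) = 0
  · have := hx (τ.symm (y j)) (by omega)
    omega
  · have := hx _ h
    omega

lemma line_right {q μ ν : ℂ} (hq : ∀ k : ℕ, 1 ≤ k → q ^ k ≠ 1) (hν : ∀ k : ℕ, ν * q ^ k ≠ 1)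
    (hμ : μ = 0 → ν = 0) {N : ℕ} {u : Fin N → ℂ} (hu1 : ∀ i, u i ≠ 1)
    (hνu : ∀ i, ν * u i ≠ 1) :
    RightEigenEq (conjMarkovMatrix q μ ν (lineOcc (N := N))) (betheEigenvalue μ ν u)
        (fun x => betheFn q ν u x) ∧
      RightEigenEq (markovMatrix q μ ν (lineOcc (N := N))) (betheEigenvalue μ ν u)
        (fun x => stationaryMeasure q ν lineOcc x * betheFn q ν u x) := by
  refine rightEigenEq_of_sum hq hν hμ lineOcc_injective
    (fun x p hp => exists_lineOcc_eq_transport _ x hp) _ _ fun x y hy => ?_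
  obtain ⟨B, hB⟩ := exists_bound x
  have hyB := fun p hp => lineOcc_transport_bound (by intro i; simp) hp (hy p hp) hB
  have hout : ∀ s : ℤ, s ≤ -(B : ℤ) ∨ (B : ℤ) ≤ s → lineOcc x s = 0 := by
    intro s hs
    by_contra h
    obtain ⟨j, rfl⟩ := exists_of_occupation_ne_zero h
    have := hB j
    omega
  -- The window `[-B, B]` has `2 * B + 1` sites. The particles start strictly inside, so it contains
  -- every jump and its edge sites are empty.
  refine sum_jumpWeight_mul_betheFn hq hν hμ hu1 hνu (coord := fun z : LineConfig N => z)
    (fun z => z.monotone) (e := id) (fun i => by simp) (-(B : ℤ)) (2 * B) ?_ ?_ ?_ ?_ ?_ hy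
    ?_ ?_ ?_
  · intro k l h
    exact Fin.ext (by simpa using h)
  · intro z k _
    exact lineOcc_apply z _
  · intro j
    exact (hB j).1.le
  · intro j
    have := hB j
    push_cast
    omega
  · intro s hs
    obtain ⟨j, rfl⟩ := exists_of_occupation_ne_zero hs
    have := hB j
    exact ⟨(x j + B).toNat, by omega, by simp only [id]; omega⟩
  · intro p hp j
    exact (hyB p hp j).1
  · intro p hp j
    have := hyB p hp j
    push_cast
    omega
  · refine Or.inr ⟨hout _ (Or.inl le_rfl), hout _ (Or.inr ?_)⟩
    simp only [id]
    push_cast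
    omega

lemma line_left {q μ ν : ℂ} (hq : ∀ k : ℕ, 1 ≤ k → q ^ k ≠ 1) (hν : ∀ k : ℕ, ν * q ^ k ≠ 1)
    (hμ : μ = 0 → ν = 0) {N : ℕ} {u : Fin N → ℂ} (hu1 : ∀ i, u i ≠ 1)
    (hνu : ∀ i, ν * u i ≠ 1) :
    LeftEigenEq (markovMatrix q μ ν (lineOcc (N := N))) (betheEigenvalue μ ν u)
      (fun x => betheFn q ν u (parity x)) := by
  refine leftEigenEq_of_sum lineOcc_injective
    (fun x p hp => exists_lineOcc_eq_transport _ x hp) _ _ fun x y hy => ?_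
  obtain ⟨B, hB⟩ := exists_bound x
  have hyB := fun p hp => lineOcc_transport_bound (by intro i; simp) hp (hy p hp) hB
  have hout : ∀ s : ℤ, s ≤ -(B : ℤ) ∨ (B : ℤ) ≤ s → lineOcc x s = 0 := by
    intro s hs
    by_contra h
    obtain ⟨j, rfl⟩ := exists_of_occupation_ne_zero h
    have := hB j
    omega
  -- With sites labelled by `-i`, jumps to the right lower the reflected coordinate by one, as
  -- required.
  refine sum_jumpWeight_mul_betheFn hq hν hμ hu1 hνu (coord := fun z : LineConfig N => parity z)
    (fun z => monotone_parity z.monotone) (e := fun i => -i) (fun i => by simp; ring) (-(B : ℤ))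
    (2 * B) ?_ ?_ ?_ ?_ ?_ hy ?_ ?_ ?_
  · intro k l h
    exact Fin.ext (by simpa using h)
  · intro z k _
    rw [card_filter_parity]
    exact lineOcc_apply z _
  · intro j
    have := hB j.rev
    simp only [parity]
    omega
  · intro j
    have := hB j.rev
    simp only [parity]
    push_cast
    omega
  · intro s hs
    obtain ⟨j, rfl⟩ := exists_of_occupation_ne_zero hs
    have := hB j
    exact ⟨(B - x j).toNat, by omega, by omega⟩
  · intro p hp j
    have := hyB p hp j.rev
    simp only [parity]
    omega
  · intro p hp j
    have := hyB p hp j.rev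
    simp only [parity]
    push_cast
    omega
  · refine Or.inr ⟨hout _ (Or.inr (by omega)), hout _ (Or.inl ?_)⟩
    push_cast
    omega

lemma ringOcc_apply {L N : ℕ} (x : RingConfig L N) {t : ℤ} (h0 : 0 ≤ t) (hL : t < L) :
    ringOcc x (t : ZMod L) = (Finset.univ.filter fun j => ringCoord x j = t).card := by
  obtain ⟨k, rfl⟩ := Int.eq_ofNat_of_zero_le h0
  rw [ringOcc, occupation_apply]
  congr 1
  refine Finset.filter_congr fun j _ => ?_
  rw [Int.cast_natCast, ZMod.natCast_eq_natCast_iff', Nat.mod_eq_of_lt (x j).isLt,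
    Nat.mod_eq_of_lt (by exact_mod_cast hL), ringCoord, Nat.cast_inj]

/-- `ZMod (K + 1)` unfolds to `Fin (K + 1)`, which is why the ring size is written as a successor.
-/
lemma ringOcc_eq {K N : ℕ} (x : RingConfig (K + 1) N) :
    ringOcc x = occupation (Site := ZMod (K + 1))
      fun j => (Equiv.refl (Fin (K + 1)) : Fin (K + 1) ≃ ZMod (K + 1)) (x j) := by
  rw [ringOcc]
  congr 1
  funext j
  exact Fin.cast_val_eq_self (x j)

lemma ringOcc_injective {K N : ℕ} : Function.Injective (ringOcc (L := K + 1) (N := N)) := by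
  rw [funext (ringOcc_eq (K := K) (N := N))]
  exact occupation_comp_injective (Site := ZMod (K + 1)) (Equiv.refl (Fin (K + 1)))

lemma exists_ringOcc_eq_transport {K N : ℕ} (τ : ZMod (K + 1) ≃ ZMod (K + 1))
    (x : RingConfig (K + 1) N) {p : ZMod (K + 1) →₀ ℕ} (hp : p ∈ Finset.Icc 0 (ringOcc x)) :
    ∃ y : RingConfig (K + 1) N, ringOcc y = transport τ (ringOcc x) p := by
  rw [funext (ringOcc_eq (K := K) (N := N))]
  rw [ringOcc_eq] at hp
  exact exists_occupation_eq_transport (Site := ZMod (K + 1)) (Equiv.refl (Fin (K + 1))) τ x hp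

lemma monotone_ringCoord {L N : ℕ} (x : RingConfig L N) : Monotone (ringCoord x) :=
  fun i j hij => by
    have : ((x i : Fin L) : ℕ) ≤ (x j : Fin L) := x.monotone hij
    simp only [ringCoord]
    omega

lemma ringCoord_nonneg {L N : ℕ} (x : RingConfig L N) (j : Fin N) : 0 ≤ ringCoord x j :=
  Int.natCast_nonneg _

lemma ringCoord_lt {L N : ℕ} (x : RingConfig L N) (j : Fin N) : ringCoord x j < L :=
  Int.ofNat_lt.2 (x j).isLt

lemma exists_intCast_eq {K : ℕ} (s : ZMod (K + 1)) : ∃ k < K + 1, ((k : ℕ) : ZMod (K + 1)) = s :=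
  ⟨s.val, ZMod.val_lt s, ZMod.natCast_zmod_val s⟩

lemma natCast_zmod_injective (K : ℕ) :
    Function.Injective fun k : Fin (K + 1) => ((k : ℕ) : ZMod (K + 1)) := by
  intro k l h
  have h := (ZMod.natCast_eq_natCast_iff' _ _ _).1 h
  rw [Nat.mod_eq_of_lt k.isLt, Nat.mod_eq_of_lt l.isLt] at h
  exact Fin.ext h

lemma ring_right {q μ ν : ℂ} (hq : ∀ k : ℕ, 1 ≤ k → q ^ k ≠ 1) (hν : ∀ k : ℕ, ν * q ^ k ≠ 1)
    (hμ : μ = 0 → ν = 0) {N K : ℕ} {u : Fin N → ℂ} (hu1 : ∀ i, u i ≠ 1)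
    (hνu : ∀ i, ν * u i ≠ 1) (hu : ∀ i j, i ≠ j → u i ≠ q * u j)
    (hB : BetheEquations q ν (K + 1) u) :
    RightEigenEq (conjMarkovMatrix q μ ν (ringOcc (L := K + 1) (N := N))) (betheEigenvalue μ ν u)
        (fun x => betheFn q ν u (ringCoord x)) ∧
      RightEigenEq (markovMatrix q μ ν (ringOcc (L := K + 1) (N := N))) (betheEigenvalue μ ν u)
        (fun x => stationaryMeasure q ν ringOcc x * betheFn q ν u (ringCoord x)) := by
  refine rightEigenEq_of_sum hq hν hμ ringOcc_injective
    (fun x p hp => exists_ringOcc_eq_transport _ x hp) _ _ fun x y hy => ?_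
  refine sum_jumpWeight_mul_betheFn hq hν hμ hu1 hνu monotone_ringCoord
    (e := fun i => (i : ZMod (K + 1))) (fun i => by simp) 0 K ?_ ?_ ?_ ?_ ?_ hy ?_ ?_ ?_
  · simpa using natCast_zmod_injective K
  · intro z k hk
    exact ringOcc_apply z (by omega) (by push_cast; omega)
  · exact ringCoord_nonneg x
  · intro j
    rw [zero_add]
    exact ringCoord_lt x j
  · intro s _
    simpa using exists_intCast_eq s
  · intro p _ j
    exact ringCoord_nonneg _ j
  · intro p _ j
    rw [zero_add]
    exact ringCoord_lt _ j
  · refine Or.inl ⟨?_, hu, hB⟩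
    rw [zero_add, Int.cast_natCast, ZMod.natCast_self, Int.cast_zero]

lemma ring_left {q μ ν : ℂ} (hq : ∀ k : ℕ, 1 ≤ k → q ^ k ≠ 1) (hν : ∀ k : ℕ, ν * q ^ k ≠ 1)
    (hμ : μ = 0 → ν = 0) {N K : ℕ} {u : Fin N → ℂ} (hu1 : ∀ i, u i ≠ 1)
    (hνu : ∀ i, ν * u i ≠ 1) (hu : ∀ i j, i ≠ j → u i ≠ q * u j)
    (hB : BetheEquations q ν (K + 1) u) :
    LeftEigenEq (markovMatrix q μ ν (ringOcc (L := K + 1) (N := N))) (betheEigenvalue μ ν u)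
      (fun x => betheFn q ν u (parity (ringCoord x))) := by
  refine leftEigenEq_of_sum ringOcc_injective
    (fun x p hp => exists_ringOcc_eq_transport _ x hp) _ _ fun x y hy => ?_
  have hlo : ∀ (z : RingConfig (K + 1) N) j, -(K : ℤ) ≤ parity (ringCoord z) j := by
    intro z j
    have := ringCoord_lt z j.rev
    simp only [parity]
    push_cast at this
    omega
  have hhi : ∀ (z : RingConfig (K + 1) N) j,
      parity (ringCoord z) j < -(K : ℤ) + (K + 1 : ℕ) := by
    intro z j
    have := ringCoord_nonneg z j.rev
    simp only [parity]
    push_cast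
    omega
  -- The reflected coordinates of the ring fill the window from `-K` to `0`.
  refine sum_jumpWeight_mul_betheFn hq hν hμ hu1 hνu
    (fun z => monotone_parity (monotone_ringCoord z))
    (e := fun i => ((-i : ℤ) : ZMod (K + 1))) (fun i => by simp; ring) (-(K : ℤ)) K ?_ ?_
    (hlo x) (hhi x) ?_ hy (fun p _ => hlo _) (fun p _ => hhi _) ?_
  · intro k l h
    refine natCast_zmod_injective K ?_
    simpa using h
  · intro z k hk
    rw [card_filter_parity]
    exact ringOcc_apply z (by omega) (by push_cast; omega)
  · intro s _
    obtain ⟨k, hk, rfl⟩ := exists_intCast_eq s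
    refine ⟨K - k, by omega, ?_⟩
    have : -(-(K : ℤ) + ((K - k : ℕ) : ℤ)) = (k : ℕ) := by omega
    rw [this, Int.cast_natCast]
  · refine Or.inl ⟨?_, hu, hB⟩
    have : ((K + 1 : ℕ) : ZMod (K + 1)) = 0 := ZMod.natCast_self _
    rw [neg_add, Int.cast_add, Int.cast_neg ((K + 1 : ℕ) : ℤ), Int.cast_natCast, this, neg_zero,
      add_zero]

end Lattices

end Chipping

theorem mainTheorem2 (q μ ν : ℂ)
    (hq : ∀ k : ℕ, 1 ≤ k → q ^ k ≠ 1)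
    (hν : ∀ k : ℕ, ν * q ^ k ≠ 1)
    (hμ : μ = 0 → ν = 0)
    (N : ℕ) :
    -- the infinite lattice
    (Chipping.RightEigenEq
        (Chipping.markovMatrix q μ ν (Chipping.lineOcc (N := N))) 1
        (Chipping.stationaryMeasure q ν (Chipping.lineOcc (N := N))) ∧
      ∀ u : Fin N → ℂ, (∀ i, u i ≠ 1) → (∀ i, ν * u i ≠ 1) →
        (∀ i j, i < j → u i ≠ q * u j) →
        Chipping.RightEigenEq
          (Chipping.conjMarkovMatrix q μ ν (Chipping.lineOcc (N := N)))
          (Chipping.betheEigenvalue μ ν u)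
          (fun x => Chipping.betheFn q ν u x) ∧
        Chipping.RightEigenEq
          (Chipping.markovMatrix q μ ν (Chipping.lineOcc (N := N)))
          (Chipping.betheEigenvalue μ ν u)
          (fun x => Chipping.stationaryMeasure q ν Chipping.lineOcc x *
            Chipping.betheFn q ν u x) ∧
        Chipping.LeftEigenEq
          (Chipping.markovMatrix q μ ν (Chipping.lineOcc (N := N)))
          (Chipping.betheEigenvalue μ ν u)
          (fun x => Chipping.betheFn q ν u (Chipping.parity x)) ∧
        (Function.Injective u →
          (∃ x : Chipping.LineConfig N, Chipping.betheFn q ν u x ≠ 0) ∧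
          (∃ x : Chipping.LineConfig N, Chipping.stationaryMeasure q ν Chipping.lineOcc x *
            Chipping.betheFn q ν u x ≠ 0) ∧
          (∃ x : Chipping.LineConfig N, Chipping.betheFn q ν u (Chipping.parity x) ≠ 0))) ∧
    -- the ring of `L` sites
    (∀ L : ℕ, 1 ≤ L →
      Chipping.RightEigenEq
        (Chipping.markovMatrix q μ ν (Chipping.ringOcc (L := L) (N := N))) 1
        (Chipping.stationaryMeasure q ν (Chipping.ringOcc (L := L) (N := N))) ∧
      ∀ u : Fin N → ℂ, (∀ i, u i ≠ 1) → (∀ i, ν * u i ≠ 1) →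
        (∀ i j, i ≠ j → u i ≠ q * u j) →
        -- periodicity on the physical domain `x_1 ≤ … ≤ x_N ≤ x_1 + L` forces the Bethe equations
        (Function.Injective u →
          (∀ x : Fin N → ℤ, Monotone x → (∀ i j, x i ≤ x j + L) →
            Chipping.betheFn q ν u x = Chipping.betheFn q ν u (Chipping.ringShift L x)) →
          Chipping.BetheEquations q ν L u) ∧
        -- every solution of the Bethe equations yields periodicity and the eigenvectors
        (Chipping.BetheEquations q ν L u →
          (∀ x : Fin N → ℤ,
            Chipping.betheFn q ν u x = Chipping.betheFn q ν u (Chipping.ringShift L x)) ∧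
          Chipping.RightEigenEq
            (Chipping.conjMarkovMatrix q μ ν (Chipping.ringOcc (L := L) (N := N)))
            (Chipping.betheEigenvalue μ ν u)
            (fun x => Chipping.betheFn q ν u (Chipping.ringCoord x)) ∧
          Chipping.RightEigenEq
            (Chipping.markovMatrix q μ ν (Chipping.ringOcc (L := L) (N := N)))
            (Chipping.betheEigenvalue μ ν u)
            (fun x => Chipping.stationaryMeasure q ν Chipping.ringOcc x *
              Chipping.betheFn q ν u (Chipping.ringCoord x)) ∧
          Chipping.LeftEigenEq
            (Chipping.markovMatrix q μ ν (Chipping.ringOcc (L := L) (N := N)))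
            (Chipping.betheEigenvalue μ ν u)
            (fun x => Chipping.betheFn q ν u (Chipping.parity (Chipping.ringCoord x))) ∧
          (Function.Injective u →
            (∃ x : Chipping.RingConfig L N,
              Chipping.betheFn q ν u (Chipping.ringCoord x) ≠ 0) ∧
            (∃ x : Chipping.RingConfig L N, Chipping.stationaryMeasure q ν Chipping.ringOcc x *
              Chipping.betheFn q ν u (Chipping.ringCoord x) ≠ 0) ∧
            (∃ x : Chipping.RingConfig L N,
              Chipping.betheFn q ν u (Chipping.parity (Chipping.ringCoord x)) ≠ 0)))) := by
  have hst : ∀ {Site X : Type} [AddCommGroupWithOne Site] (occ : X → Site →₀ ℕ) (x : X),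
      Chipping.stationaryMeasure q ν occ x ≠ 0 :=
    fun occ x => Chipping.stationaryWeight_ne_zero hq hν (occ x)
  refine ⟨⟨Chipping.stationary_of_sector hq hν hμ Chipping.lineOcc_injective
    fun x p hp => Chipping.exists_lineOcc_eq_transport _ x hp, ?_⟩, ?_⟩
  · intro u hu1 hνu hu
    obtain ⟨h1, h2⟩ := Chipping.line_right hq hν hμ hu1 hνu
    refine ⟨h1, h2, Chipping.line_left hq hν hμ hu1 hνu, fun hinj => ?_⟩
    -- All particles at `0`: a configuration fixed by parity, so one witness serves all three
    -- functions.
    let x : Chipping.LineConfig N := ⟨fun _ => 0, monotone_const⟩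
    have hx : Chipping.betheFn q ν u x ≠ 0 := Chipping.betheFn_zero_ne_zero hq hu hinj
    refine ⟨⟨x, hx⟩, ⟨x, mul_ne_zero (hst _ _) hx⟩, ⟨x, ?_⟩⟩
    change Chipping.betheFn q ν u (Chipping.parity fun _ => 0) ≠ 0
    rw [Chipping.parity_zero]
    exact hx
  · intro L hL
    obtain ⟨K, rfl⟩ := Nat.exists_eq_succ_of_ne_zero (Nat.one_le_iff_ne_zero.1 hL)
    refine ⟨Chipping.stationary_of_sector hq hν hμ Chipping.ringOcc_injective
      fun x p hp => Chipping.exists_ringOcc_eq_transport _ x hp, ?_⟩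
    intro u hu1 hνu hu
    refine ⟨fun hinj hper => Chipping.betheEquations_of_periodic hq hν hL hu1 hνu hu hinj hper,
      fun hB => ?_⟩
    obtain ⟨h1, h2⟩ := Chipping.ring_right hq hν hμ hu1 hνu hu hB
    refine ⟨Chipping.betheFn_periodic hu1 hνu hu hB, h1, h2,
      Chipping.ring_left hq hν hμ hu1 hνu hu hB, fun hinj => ?_⟩
    let x : Chipping.RingConfig (K + 1) N := ⟨fun _ => 0, monotone_const⟩
    have hx0 : Chipping.ringCoord x = fun _ => 0 := rfl
    have hx : Chipping.betheFn q ν u (Chipping.ringCoord x) ≠ 0 := by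
      rw [hx0]
      exact Chipping.betheFn_zero_ne_zero hq (fun i j hij => hu i j hij.ne) hinj
    refine ⟨⟨x, hx⟩, ⟨x, mul_ne_zero (hst _ _) hx⟩, ⟨x, ?_⟩⟩
    rw [hx0, Chipping.parity_zero, ← hx0]
    exact hx
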